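/- Write $\mathbb{R}_+=(0,\infty)$, $\|f\|=\left(\int_0^\infty|f(Y)|^2\,dY\right)^{1/2}$, and let $H^4(\mathbb{R}_+)$ be the usual $L^2$-based Sobolev space of complex-valued functions on $\mathbb{R}_+$. Let $U_s\in C^2([0,\infty))$ be a real-valued function with $$U_s(0)=0,\quad U_s(Y)>0 \text{ for } Y>0,\quad \lim_{Y\to\infty}U_s(Y)=U_E>0,\quad U_s'(0)>0,\quad \sum_{k=1,2}\ \sup_{Y\ge 0}\,(1+Y)^3\,|\partial_Y^kU_s(Y)|<\infty ,$$ and for $\varepsilon>0$, $\alpha>0$ define the Orr–Sommerfeld operator $$OS[\phi]=U_s(\partial_Y^2-\alpha^2)\phi-U_s''\phi+i\varepsilon(\partial_Y^2-\alpha^2)^2\phi .$$ Then there exist positive numbers $\varepsilon_1,\delta_1,C$, depending only on $U_s$, such that for all $0<\varepsilon\le\varepsilon_1$ and all $\alpha>0$ with $\varepsilon^{1/3}\alpha\le\delta_1$ there exists a function $\phi_{fast}\in H^4(\mathbb{R}_+)$ with $OS[\phi_{fast}]=0$ on $\mathbb{R}_+$, $$\|\partial_Y\phi_{fast}\|+\alpha\|\phi_{fast}\|\le\frac{C}{\varepsilon^{1/6}},\qquad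 \|(\partial_Y^2-\alpha^2)\phi_{fast}\|\le\frac{C}{\varepsilon^{1/2}},$$ $$\phi_{fast}(0)=1,\qquad \partial_Y\phi_{fast}(0)=\Big(-e^{\frac{\pi}{6}i}\,U_s'(0)^{\frac13}\,3^{-\frac23}\,\Gamma(\tfrac13)+r+s\Big)\varepsilon^{-\frac13},$$ where $r,s\in\mathbb{C}$ satisfy $|r|\le C\varepsilon^{1/3}\alpha$ and $|s|\le C\varepsilon^{1/3}$. -/

import Mathlib

open MeasureTheory Set Filter Topology
open scoped ContDiff

/-- A background shear profile `U_s` of Prandtl type on the closed half-line `[0, ∞)`, with limit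
`U_E` at infinity. Derivatives on `[0, ∞)` are one-sided at `0`. The values of `Us` on the negative
half-line play no role. -/
structure IsPrandtlProfile (Us : ℝ → ℝ) (UE : ℝ) : Prop where
  contDiffOn : ContDiffOn ℝ 2 Us (Ici 0)
  map_zero : Us 0 = 0
  pos : ∀ Y : ℝ, 0 < Y → 0 < Us Y
  limit_pos : 0 < UE
  tendsto_atTop : Tendsto Us atTop (𝓝 UE)
  deriv_zero_pos : 0 < derivWithin Us (Ici 0) 0
  decay : ∀ k ∈ ({1, 2} : Set ℕ),
    ∃ M : ℝ, ∀ Y : ℝ, 0 ≤ Y → (1 + Y) ^ 3 * |iteratedDerivWithin k Us (Ici 0) Y| ≤ M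

/-- Lebesgue measure on the half-line `ℝ₊ = (0, ∞)`. -/
noncomputable def halfLine : Measure ℝ := volume.restrict (Ioi 0)

/-- `g'` is the weak (distributional) derivative of `g` on `(0, ∞)`. -/
def HasWeakDeriv (g g' : ℝ → ℂ) : Prop :=
  LocallyIntegrableOn g (Ioi 0) volume ∧ LocallyIntegrableOn g' (Ioi 0) volume ∧
    ∀ η : ℝ → ℝ, ContDiff ℝ ∞ η → HasCompactSupport η → tsupport η ⊆ Ioi 0 →
      ∫ Y in Ioi (0 : ℝ), deriv η Y • g Y = -∫ Y in Ioi (0 : ℝ), η Y • g' Y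

/-- An element of the Sobolev space `H^k(ℝ₊)` of complex-valued functions: a function `d 0` on
`(0, ∞)` together with (representatives of) its successive weak derivatives `d 1, …, d k`, all of
them in `L²(ℝ₊)`. The `d j` with `1 ≤ j ≤ k` are determined by `d 0` almost everywhere on `(0, ∞)`;
the `d j` with `j > k` carry no information. -/
structure SobolevH (k : ℕ) where
  d : ℕ → ℝ → ℂ
  memLp : ∀ j ≤ k, MemLp (d j) 2 halfLine
  weakDeriv : ∀ j < k, HasWeakDeriv (d j) (d (j + 1))

/-- The boundary value at `Y = 0` of (the continuous representative on `[0, ∞)` of) `g` is `a`. -/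
def HasBoundaryValue (g : ℝ → ℂ) (a : ℂ) : Prop :=
  ∃ h : ℝ → ℂ, ContinuousOn h (Ici 0) ∧ g =ᵐ[halfLine] h ∧ h 0 = a

/-- The norm of `L²(ℝ₊)`. -/
noncomputable def normL2 (g : ℝ → ℂ) : ℝ := Real.sqrt (∫ Y in Ioi (0 : ℝ), ‖g Y‖ ^ 2)

/-- `(∂_Y² - α²) φ` -/
noncomputable def helmholtz (α : ℝ) (φ : SobolevH 4) (Y : ℝ) : ℂ :=
  φ.d 2 Y - (α : ℂ) ^ 2 * φ.d 0 Y

/-- `(∂_Y² - α²)² φ = ∂_Y⁴ φ - 2 α² ∂_Y² φ + α⁴ φ` -/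
noncomputable def helmholtzSq (α : ℝ) (φ : SobolevH 4) (Y : ℝ) : ℂ :=
  φ.d 4 Y - 2 * (α : ℂ) ^ 2 * φ.d 2 Y + (α : ℂ) ^ 4 * φ.d 0 Y

/-- The Rayleigh operator `Ray[φ] = U_s (∂_Y² - α²) φ - U_s'' φ`. -/
noncomputable def rayleigh (Us : ℝ → ℝ) (α : ℝ) (φ : SobolevH 4) (Y : ℝ) : ℂ :=
  (Us Y : ℂ) * helmholtz α φ Y - ((iteratedDerivWithin 2 Us (Ici 0) Y : ℝ) : ℂ) * φ.d 0 Y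

/-- The Orr-Sommerfeld operator `OS[φ] = Ray[φ] + i ε (∂_Y² - α²)² φ`. -/
noncomputable def orrSommerfeld (Us : ℝ → ℝ) (ε α : ℝ) (φ : SobolevH 4) (Y : ℝ) : ℂ :=
  rayleigh Us α φ Y + Complex.I * (ε : ℂ) * helmholtzSq α φ Y

/-- `e^{iπ/6} U_s'(0)^{1/3} 3^{-2/3} Γ(1/3)` -/
noncomputable def fastModeCoeff (Us : ℝ → ℝ) : ℂ :=
  Complex.exp (Complex.I * (Real.pi / 6 : ℝ)) *
    ((derivWithin Us (Ici 0) 0 ^ (1 / 3 : ℝ) * (3 : ℝ) ^ (-(2 / 3) : ℝ) *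
      Real.Gamma (1 / 3) : ℝ) : ℂ)

/-! Put `δ = ε^(1/3)`, `z = Y/δ`, `a = δα`. With `V z = Us (δz)/δ` and `V₂ z = δ Us'' (δz)` the
equation becomes `V w - V₂ ψ + i(∂² - a²)w = 0`, `w = (∂² - a²)ψ`. As `V z = bz + O(δz²)`, `b =
Us'(0)`, and `V₂ = O(δ)`, the vorticity satisfies `w'' = ibzw + O(δ + a)`: an Airy equation with a
small defect.

Existence is by shooting. On `[0, R]` three conditions `ψ = p = w = 0` at `R` leave a nonzero
solution of the four-dimensional system. Testing the equation with `(1 + i)w` in the weight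
`e^(2θz)` controls `∫ |w'|² + V|w|²`; `weighted_hardy` recovers `∫ |w|²`, and `weighted_transport`
recovers `p = (∂ + a)ψ` and `ψ`. The resulting bounds are uniform in `R`, `δ`, `a`
(`exists_uniform_bounds`), so `R → ∞` yields a decaying solution.

The boundary slope is found without Airy functions. If `d³ = -i` and `Re d ≥ 0`, then `u = d ∫₀^∞
exp(-zdτ - τ³/(3b)) dτ` solves `u'' = ibzu - ib`. Testing `w` against `u` (`wronskian_identity`)
gives a linear relation between `∫ w` and `w'(0)`. The two roots `d = i` and `d = e^(-iπ/6)`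
determine both numbers up to `O(δ + a)`. Since `ψ'(0) ≈ -∫ w`, `ψ(0) ≈ ∫ zw` and `ib ∫ zw ≈ -w'(0)`,
it follows that `ψ'(0)/ψ(0) ≈ -e^(iπ/6) G₀`, where `G₀ = ∫₀^∞ exp(-τ³/(3b)) dτ = b^(1/3) 3^(-2/3)
Γ(1/3)`. The same relations keep `ψ(0)` away from zero, so it can be normalised to 1; undoing the
scaling gives the powers of `ε`. -/

/-! ### Global solutions of linear ODEs in a Banach space. -/

open scoped BoundedContinuousFunction in
theorem exists_hasDerivAt_linear_flow {F : Type*} [NormedAddCommGroup F] [NormedSpace ℝ F]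
    [CompleteSpace F] (B : ℝ → F →L[ℝ] F) (hB : Continuous B) (K : ℝ) (hK : ∀ t, ‖B t‖ ≤ K)
    (x₀ : F) :
    ∃ Y : ℝ → F, Y 0 = x₀ ∧ ∀ t, 0 ≤ t → HasDerivAt Y (B t (Y t)) t := by
  have hK0 : 0 ≤ K := (norm_nonneg _).trans (hK 0)
  -- The unknown is `v t = exp (-l t) Y t`. With this rate the Picard map has Lipschitz constant at
  -- most `K / l ≤ 1/2` on the whole half-line, so no gluing of local solutions is needed.
  set l : ℝ := 2 * K + 1 with hl
  have hlpos : 0 < l := by positivity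
  have hcont : ∀ v : ℝ →ᵇ F, Continuous fun s : ℝ => Real.exp (l * s) • B s (v s) := fun v => by
    have h1 : Continuous fun s => B s (v s) := hB.clm_apply v.continuous
    fun_prop
  have hint : ∀ (v : ℝ →ᵇ F) (a b : ℝ),
      IntervalIntegrable (fun s : ℝ => Real.exp (l * s) • B s (v s)) volume a b :=
    fun v a b => (hcont v).intervalIntegrable a b
  have hexp : ∀ t : ℝ, ∫ s in (0 : ℝ)..t, Real.exp (l * s) = (Real.exp (l * t) - 1) / l := by
    intro t
    rw [intervalIntegral.integral_comp_mul_left (fun x => Real.exp x) hlpos.ne']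
    simp [div_eq_inv_mul]
  have hbound : ∀ (f : ℝ → F) (N : ℝ), 0 ≤ N → (∀ s, ‖f s‖ ≤ Real.exp (l * s) * (K * N)) →
      ∀ t : ℝ, 0 ≤ t → ‖Real.exp (-(l * t)) • ∫ s in (0 : ℝ)..t, f s‖ ≤ N / 2 := by
    intro f N hN hf t ht
    have h1 : ‖∫ s in (0 : ℝ)..t, f s‖ ≤ ∫ s in (0 : ℝ)..t, Real.exp (l * s) * (K * N) :=
      intervalIntegral.norm_integral_le_of_norm_le ht (Eventually.of_forall fun s _ => hf s)
        (Continuous.intervalIntegrable (by fun_prop) _ _)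
    rw [intervalIntegral.integral_mul_const, hexp] at h1
    rw [norm_smul, Real.norm_of_nonneg (Real.exp_pos _).le, Real.exp_neg]
    have h2 := Real.exp_pos (l * t)
    rw [inv_mul_le_iff₀ h2]
    refine h1.trans ?_
    have h3 : (Real.exp (l * t) - 1) / l * (K * N) = (Real.exp (l * t) - 1) * N * (K / l) := by
      field_simp
    rw [h3]
    have h4 : K / l ≤ 1 / 2 := by rw [div_le_div_iff₀ hlpos two_pos]; linarith
    have h5 : 1 ≤ Real.exp (l * t) := Real.one_le_exp (by positivity)
    calc (Real.exp (l * t) - 1) * N * (K / l) ≤ (Real.exp (l * t) - 1) * N * (1 / 2) := by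
          gcongr
      _ ≤ Real.exp (l * t) * N * (1 / 2) := by gcongr; linarith
      _ = _ := by ring
  have hvb : ∀ (v : ℝ →ᵇ F) (s : ℝ),
      ‖Real.exp (l * s) • B s (v s)‖ ≤ Real.exp (l * s) * (K * ‖v‖) := by
    intro v s
    rw [norm_smul, Real.norm_of_nonneg (Real.exp_pos _).le]
    gcongr
    exact ((B s).le_opNorm _).trans (mul_le_mul (hK s) (v.norm_coe_le_norm s) (norm_nonneg _) hK0)
  -- `max t 0` extends the map as a constant to negative times, keeping it inside bounded continuous
  -- functions on `ℝ`.
  let T : (ℝ →ᵇ F) → (ℝ →ᵇ F) := fun v =>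
    BoundedContinuousFunction.ofNormedAddCommGroup
      (fun t => Real.exp (-(l * max t 0)) •
        (x₀ + ∫ s in (0 : ℝ)..(max t 0), Real.exp (l * s) • B s (v s)))
      (by
        have h1 : Continuous fun t : ℝ => ∫ s in (0 : ℝ)..t, Real.exp (l * s) • B s (v s) :=
          intervalIntegral.continuous_primitive (fun a b => hint v a b) 0
        have h2 : Continuous fun t : ℝ => max t (0 : ℝ) := by fun_prop
        have h3 := h1.comp h2
        simp only [Function.comp_def] at h3
        fun_prop)
      (‖x₀‖ + ‖v‖ / 2)
      (by
        intro t
        rw [smul_add]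
        refine (norm_add_le _ _).trans (add_le_add ?_ (hbound _ _ (norm_nonneg v) (hvb v) _
          (le_max_right _ _)))
        rw [norm_smul, Real.norm_of_nonneg (Real.exp_pos _).le]
        refine mul_le_of_le_one_left (norm_nonneg _) (Real.exp_le_one_iff.2 ?_)
        have := le_max_right t 0
        nlinarith)
  have hT : ∀ v t, T v t = Real.exp (-(l * max t 0)) •
        (x₀ + ∫ s in (0 : ℝ)..(max t 0), Real.exp (l * s) • B s (v s)) := fun v t => rfl
  have hcontr : ContractingWith (1 / 2) T := by
    refine ⟨by norm_num, LipschitzWith.of_dist_le_mul fun u v => ?_⟩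
    rw [BoundedContinuousFunction.dist_le (by positivity)]
    intro t
    rw [dist_eq_norm, hT, hT, ← smul_sub, add_sub_add_left_eq_sub,
      ← intervalIntegral.integral_sub (hint u _ _) (hint v _ _)]
    have := hbound (fun s => Real.exp (l * s) • B s (u s) - Real.exp (l * s) • B s (v s))
      ‖u - v‖ (norm_nonneg _) (fun s => by
        have := hvb (u - v) s
        simpa [smul_sub] using this) (max t 0) (le_max_right _ _)
    refine this.trans (le_of_eq ?_)
    rw [dist_eq_norm]
    push_cast
    ring
  obtain ⟨v, hv⟩ : ∃ v, T v = v := ⟨_, hcontr.fixedPoint_isFixedPt⟩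
  have hv' : ∀ t, 0 ≤ t → Real.exp (l * t) • v t =
      x₀ + ∫ s in (0 : ℝ)..t, Real.exp (l * s) • B s (v s) := by
    intro t ht
    conv_lhs => rw [← hv]
    rw [hT, max_eq_left ht, smul_smul, ← Real.exp_add]
    simp
  refine ⟨fun t => x₀ + ∫ s in (0 : ℝ)..t, Real.exp (l * s) • B s (v s), by simp, fun t ht => ?_⟩
  have h1 := (intervalIntegral.integral_hasDerivAt_right (hint v 0 t)
    ((hcont v).stronglyMeasurableAtFilter _ _) (hcont v).continuousAt).const_add x₀
  convert! h1 using 1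
  simp only [← hv' t ht, map_smul]

/-! ### The problem in boundary layer variables. -/

/-- The Orr-Sommerfeld equation `V w - V₂ ψ + i (∂² - a²) w = 0`, `w = (∂² - a²) ψ`, in boundary
layer variables, as a first order system with `p = (∂ + a) ψ`. -/
structure IsFastSystem (a : ℝ) (V V₂ : ℝ → ℝ) (ψ p w w₁ : ℝ → ℂ) (s : Set ℝ) : Prop where
  hasDerivAt_psi : ∀ z ∈ s, HasDerivAt ψ (p z - a * ψ z) z
  hasDerivAt_p : ∀ z ∈ s, HasDerivAt p (a * p z + w z) z
  hasDerivAt_w : ∀ z ∈ s, HasDerivAt w (w₁ z) z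
  hasDerivAt_w₁ : ∀ z ∈ s, HasDerivAt w₁
    (a ^ 2 * w z + Complex.I * V z * w z - Complex.I * V₂ z * ψ z) z

/-- A shear profile `V` and its second derivative `V₂` in boundary layer variables: `V z = b z` up
to `O(δ z ^ 2)`, and `V₂ = O(δ)`. -/
structure IsScaledProfile (b M c δ : ℝ) (V V₂ : ℝ → ℝ) : Prop where
  continuous : Continuous V
  continuous₂ : Continuous V₂
  lower : ∀ z, 0 ≤ z → c * (z / (1 + z)) ≤ V z
  taylor : ∀ z, 0 ≤ z → |V z - b * z| ≤ M * δ * z ^ 2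
  bound₂ : ∀ z, 0 ≤ z → |V₂ z| ≤ M * δ
  bounded : ∃ K, ∀ z, |V z| ≤ K ∧ |V₂ z| ≤ K

/-! ### Exponentially weighted inequalities on `[0, R]`. -/

theorem integral_le_sub_of_hasDerivAt {F F' g : ℝ → ℝ} {x R : ℝ} (hxR : x ≤ R)
    (hF : ∀ z ∈ Icc x R, HasDerivAt F (F' z) z) (hg : ContinuousOn g (Icc x R))
    (hle : ∀ z ∈ Icc x R, g z ≤ F' z) : ∫ z in x..R, g z ≤ F R - F x :=
  intervalIntegral.integral_le_sub_of_hasDeriv_right_of_le hxR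
    (fun z hz => (hF z hz).continuousAt.continuousWithinAt)
    (fun z hz => (hF z (Ioo_subset_Icc_self hz)).hasDerivWithinAt)
    (hg.integrableOn_compact isCompact_Icc) (fun z hz => hle z (Ioo_subset_Icc_self hz))

theorem le_integral_of_hasDerivAt_of_eq_zero {F F' g : ℝ → ℝ} {x R : ℝ} (hx : x ∈ Icc 0 R)
    (hF : ∀ z ∈ Icc 0 R, HasDerivAt F (F' z) z) (hR : F R = 0) (hg : ContinuousOn g (Icc 0 R))
    (hg0 : ∀ z ∈ Icc 0 R, 0 ≤ g z) (hle : ∀ z ∈ Icc 0 R, -g z ≤ F' z) :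
    F x ≤ ∫ z in (0 : ℝ)..R, g z := by
  have hsub : Icc x R ⊆ Icc 0 R := Icc_subset_Icc_left hx.1
  have h1 := integral_le_sub_of_hasDerivAt hx.2 (fun z hz => hF z (hsub hz))
    (hg.mono hsub).neg (fun z hz => hle z (hsub hz))
  simp only [Pi.neg_apply, intervalIntegral.integral_neg, hR] at h1
  have h2 : ∫ z in x..R, g z ≤ ∫ z in (0 : ℝ)..R, g z := by
    refine intervalIntegral.integral_mono_interval hx.1 hx.2 le_rfl ?_ ?_
    · filter_upwards [ae_restrict_mem measurableSet_Ioc] with z hz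
      exact hg0 z (Ioc_subset_Icc_self hz)
    · exact hg.intervalIntegrable_of_Icc (hx.1.trans hx.2)
  linarith

theorem hasDerivAt_exp_mul {θ f' z : ℝ} {f : ℝ → ℝ} (hf : HasDerivAt f f' z) :
    HasDerivAt (fun z => Real.exp (2 * θ * z) * f z)
      (Real.exp (2 * θ * z) * (2 * θ * f z + f')) z := by
  have h := (((hasDerivAt_id z).const_mul (2 * θ)).exp).mul hf
  convert! h using 1
  simp
  ring

theorem abs_two_mul_inner_le {κ : ℝ} (hκ : 0 < κ) (x y : ℂ) :
    |2 * inner ℝ x y| ≤ κ * ‖x‖ ^ 2 + ‖y‖ ^ 2 / κ := by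
  rw [abs_mul, abs_two]
  have h := abs_real_inner_le_norm x y
  have h2 : κ * ‖x‖ ^ 2 + ‖y‖ ^ 2 / κ - 2 * (‖x‖ * ‖y‖) = (κ * ‖x‖ - ‖y‖) ^ 2 / κ := by
    field_simp
    ring
  have h3 : 0 ≤ (κ * ‖x‖ - ‖y‖) ^ 2 / κ := by positivity
  linarith

section Weighted

variable {θ R : ℝ} {u u' f : ℝ → ℂ}

theorem continuousOn_weighted_sq (hu : ContinuousOn u (Icc 0 R)) :
    ContinuousOn (fun z => Real.exp (2 * θ * z) * ‖u z‖ ^ 2) (Icc 0 R) := by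
  fun_prop

/-- With `q = z/(1+z)`, the function `e^(2θz) q|u|²` vanishes at both ends, so no boundary value of
`u` at 0 enters. The derivative of the weight has a good sign, `2q⟨u, u'⟩ ≥ -q|u|² - |u'|²`, and `q'
+ q = 1 - s + s² ≥ 3/4` with `s = 1/(1+z)`. -/
theorem weighted_hardy (hθ : 0 ≤ θ) (hR : 0 ≤ R) (hu : ∀ z ∈ Icc 0 R, HasDerivAt u (u' z) z)
    (hu' : ContinuousOn u' (Icc 0 R)) (huR : u R = 0) :
    3 / 4 * ∫ z in (0 : ℝ)..R, Real.exp (2 * θ * z) * ‖u z‖ ^ 2 ≤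
      ∫ z in (0 : ℝ)..R, Real.exp (2 * θ * z) * (‖u' z‖ ^ 2 + 2 * (z / (1 + z)) * ‖u z‖ ^ 2) := by
  have huc : ContinuousOn u (Icc 0 R) := fun z hz => (hu z hz).continuousAt.continuousWithinAt
  have hq : ContinuousOn (fun z : ℝ => z / (1 + z)) (Icc 0 R) := by
    refine ContinuousOn.div (by fun_prop) (by fun_prop) fun z hz => ?_
    have := hz.1
    positivity
  have hc1 := continuousOn_weighted_sq (θ := θ) huc
  have hc2 : ContinuousOn (fun z => Real.exp (2 * θ * z) *
      (‖u' z‖ ^ 2 + 2 * (z / (1 + z)) * ‖u z‖ ^ 2)) (Icc 0 R) := by fun_prop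
  have hF : ∀ z ∈ Icc 0 R, HasDerivAt (fun z => Real.exp (2 * θ * z) * (z / (1 + z) * ‖u z‖ ^ 2))
      (Real.exp (2 * θ * z) * (2 * θ * (z / (1 + z) * ‖u z‖ ^ 2) +
        (1 / (1 + z) ^ 2 * ‖u z‖ ^ 2 + z / (1 + z) * (2 * inner ℝ (u z) (u' z))))) z := by
    intro z hz
    have h0 : 1 + z ≠ 0 := by have := hz.1; positivity
    have h1 : HasDerivAt (fun z : ℝ => z / (1 + z)) (1 / (1 + z) ^ 2) z := by
      have := (hasDerivAt_id z).div ((hasDerivAt_id z).const_add 1) h0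
      convert! this using 1
      simp
    exact hasDerivAt_exp_mul (h1.mul (hu z hz).norm_sq)
  have key := integral_le_sub_of_hasDerivAt hR hF
    ((hc1.const_smul (3 / 4 : ℝ)).sub hc2) (fun z hz => by
      have hz0 := hz.1
      have h0 : 0 < 1 + z := by positivity
      have h1 := (abs_le.1 (abs_two_mul_inner_le one_pos (u z) (u' z))).1
      have hq0 : 0 ≤ z / (1 + z) := by positivity
      have hq1 : z / (1 + z) ≤ 1 := by rw [div_le_one h0]; linarith
      have h2 : 3 / 4 ≤ 1 / (1 + z) ^ 2 + z / (1 + z) := by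
        rw [div_add_div _ _ (by positivity) h0.ne', div_le_div_iff₀ (by norm_num) (by positivity)]
        nlinarith [mul_nonneg h0.le (sq_nonneg (z - 1))]
      simp only [Pi.smul_apply, smul_eq_mul, Pi.sub_apply]
      rw [mul_left_comm, ← mul_sub]
      refine mul_le_mul_of_nonneg_left ?_ (Real.exp_pos _).le
      have h3 := mul_le_mul_of_nonneg_right h2 (sq_nonneg ‖u z‖)
      have h4 := mul_le_mul_of_nonneg_left h1 hq0
      have h5 := mul_le_mul_of_nonneg_right hq1 (sq_nonneg ‖u' z‖)
      have h6 : 0 ≤ 2 * θ * (z / (1 + z) * ‖u z‖ ^ 2) := by positivity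
      rw [div_one] at h4
      linarith)
  simp only [Pi.smul_apply, smul_eq_mul, Pi.sub_apply, huR] at key
  rw [intervalIntegral.integral_sub, intervalIntegral.integral_const_mul] at key
  · simp only [norm_zero, zero_div, zero_mul, mul_zero] at key
    norm_num at key
    linarith
  · exact (hc1.intervalIntegrable_of_Icc hR).const_mul _
  · exact hc2.intervalIntegrable_of_Icc hR

theorem weighted_sq_le_integral (hθ : 0 ≤ θ) (hu : ∀ z ∈ Icc 0 R, HasDerivAt u (u' z) z)
    (hu' : ContinuousOn u' (Icc 0 R)) (huR : u R = 0) {x : ℝ} (hx : x ∈ Icc 0 R) :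
    Real.exp (2 * θ * x) * ‖u x‖ ^ 2 ≤
      ∫ z in (0 : ℝ)..R, Real.exp (2 * θ * z) * (‖u z‖ ^ 2 + ‖u' z‖ ^ 2) := by
  have huc : ContinuousOn u (Icc 0 R) := fun z hz => (hu z hz).continuousAt.continuousWithinAt
  refine le_integral_of_hasDerivAt_of_eq_zero (F := fun z => Real.exp (2 * θ * z) * ‖u z‖ ^ 2) hx
    (fun z hz => hasDerivAt_exp_mul (hu z hz).norm_sq) (by simp [huR]) (by fun_prop)
    (fun z hz => by positivity) (fun z hz => ?_)
  rw [← mul_neg]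
  refine mul_le_mul_of_nonneg_left ?_ (Real.exp_pos _).le
  have h1 := (abs_le.1 (abs_two_mul_inner_le one_pos (u z) (u' z))).1
  rw [div_one] at h1
  have : 0 ≤ 2 * θ * ‖u z‖ ^ 2 := by positivity
  linarith

/-- The growth of the weight supplies coercivity: `(e^(2θz)|u|²)' ≥ e^(2θz)(κ|u|² - |f|²/κ)`. The
sign of `k` is free as long as `θ + k ≥ κ`, so the same lemma serves `p` with `k = a` and `ψ` with
`k = -a`. -/
theorem weighted_transport {κ k : ℝ} (hκ : 0 < κ) (hk : κ ≤ θ + k) (hR : 0 ≤ R)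
    (hu : ∀ z ∈ Icc 0 R, HasDerivAt u (k * u z + f z) z)
    (hf : ContinuousOn f (Icc 0 R)) (huR : u R = 0) :
    (∫ z in (0 : ℝ)..R, Real.exp (2 * θ * z) * ‖u z‖ ^ 2 ≤
      1 / κ ^ 2 * ∫ z in (0 : ℝ)..R, Real.exp (2 * θ * z) * ‖f z‖ ^ 2) ∧
    ∀ x ∈ Icc 0 R, Real.exp (2 * θ * x) * ‖u x‖ ^ 2 ≤
      1 / κ * ∫ z in (0 : ℝ)..R, Real.exp (2 * θ * z) * ‖f z‖ ^ 2 := by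
  have huc : ContinuousOn u (Icc 0 R) := fun z hz => (hu z hz).continuousAt.continuousWithinAt
  have hc1 := continuousOn_weighted_sq (θ := θ) huc
  have hc2 := continuousOn_weighted_sq (θ := θ) hf
  have hF : ∀ z ∈ Icc 0 R, HasDerivAt (fun z => Real.exp (2 * θ * z) * ‖u z‖ ^ 2)
      (Real.exp (2 * θ * z) * (2 * θ * ‖u z‖ ^ 2 + 2 * inner ℝ (u z) (k * u z + f z))) z :=
    fun z hz => hasDerivAt_exp_mul (hu z hz).norm_sq
  have hle : ∀ z, κ * ‖u z‖ ^ 2 - 1 / κ * ‖f z‖ ^ 2 ≤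
      2 * θ * ‖u z‖ ^ 2 + 2 * inner ℝ (u z) (k * u z + f z) := by
    intro z
    have h1 := (abs_le.1 (abs_two_mul_inner_le hκ (u z) (f z))).1
    have h2 : inner ℝ (u z) ((k : ℂ) * u z) = k * ‖u z‖ ^ 2 := by
      rw [← Complex.real_smul, inner_smul_right, real_inner_self_eq_norm_sq]
    rw [inner_add_right, h2]
    have h3 := mul_le_mul_of_nonneg_right hk (sq_nonneg ‖u z‖)
    have h4 : ‖f z‖ ^ 2 / κ = 1 / κ * ‖f z‖ ^ 2 := by ring
    linarith
  constructor
  · have key := integral_le_sub_of_hasDerivAt hR hF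
      ((hc1.const_smul κ).sub (hc2.const_smul (1 / κ))) (fun z hz => by
        simp only [Pi.smul_apply, smul_eq_mul, Pi.sub_apply]
        rw [mul_left_comm, mul_left_comm (1 / κ), ← mul_sub]
        exact mul_le_mul_of_nonneg_left (hle z) (Real.exp_pos _).le)
    simp only [Pi.smul_apply, smul_eq_mul, Pi.sub_apply, huR] at key
    rw [intervalIntegral.integral_sub, intervalIntegral.integral_const_mul,
      intervalIntegral.integral_const_mul] at key
    · have h0 := sq_nonneg ‖u 0‖
      have h1 : κ * (∫ z in (0 : ℝ)..R, Real.exp (2 * θ * z) * ‖u z‖ ^ 2) ≤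
          1 / κ * ∫ z in (0 : ℝ)..R, Real.exp (2 * θ * z) * ‖f z‖ ^ 2 := by
        simp only [norm_zero] at key
        norm_num at key ⊢
        linarith
      rw [← le_div_iff₀' hκ] at h1
      refine h1.trans (le_of_eq ?_)
      field_simp
    · exact (hc1.intervalIntegrable_of_Icc hR).const_mul _
    · exact (hc2.intervalIntegrable_of_Icc hR).const_mul _
  · intro x hx
    rw [← intervalIntegral.integral_const_mul]
    refine le_integral_of_hasDerivAt_of_eq_zero
      (F := fun z => Real.exp (2 * θ * z) * ‖u z‖ ^ 2) hx hF (by simp [huR]) (by fun_prop)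
      (fun z hz => by positivity) (fun z hz => ?_)
    rw [mul_left_comm, ← mul_neg]
    refine mul_le_mul_of_nonneg_left ?_ (Real.exp_pos _).le
    have := hle z
    have h0 : 0 ≤ κ * ‖u z‖ ^ 2 := by positivity
    linarith

end Weighted

/-! ### Energy estimate and a priori bounds. -/

/-- Pairing with `x` produces `a²|x|²`, pairing with `ix` produces `V|x|²`; the terms in `V₂` are
the only ones without a sign. -/
theorem inner_forcing_lower (x s : ℂ) (a V V₂ m : ℝ) (hm : |V₂| ≤ m) :
    V * ‖x‖ ^ 2 - m * (‖x‖ ^ 2 + ‖s‖ ^ 2) ≤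
      inner ℝ x (a ^ 2 * x + Complex.I * V * x - Complex.I * V₂ * s) +
        inner ℝ (Complex.I * x) (a ^ 2 * x + Complex.I * V * x - Complex.I * V₂ * s) := by
  have h0 : inner ℝ x (a ^ 2 * x + Complex.I * V * x - Complex.I * V₂ * s) +
        inner ℝ (Complex.I * x) (a ^ 2 * x + Complex.I * V * x - Complex.I * V₂ * s) =
      a ^ 2 * ‖x‖ ^ 2 + V * ‖x‖ ^ 2 - V₂ * (inner ℝ x (Complex.I * s) + inner ℝ x s) := by
    rw [← Complex.ofReal_pow]
    generalize a ^ 2 = A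
    simp only [Complex.inner, Complex.sq_norm, Complex.normSq_apply]
    simp
    ring
  have h1 : |inner ℝ x (Complex.I * s) + inner ℝ x s| ≤ ‖x‖ ^ 2 + ‖s‖ ^ 2 := by
    have e1 := abs_real_inner_le_norm x (Complex.I * s)
    have e2 := abs_real_inner_le_norm x s
    rw [norm_mul, Complex.norm_I, one_mul] at e1
    have e3 := abs_add_le (inner ℝ x (Complex.I * s)) (inner ℝ x s)
    nlinarith [sq_nonneg (‖x‖ - ‖s‖)]
  have h2 : V₂ * (inner ℝ x (Complex.I * s) + inner ℝ x s) ≤ m * (‖x‖ ^ 2 + ‖s‖ ^ 2) := by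
    refine (le_abs_self _).trans ?_
    rw [abs_mul]
    exact mul_le_mul hm h1 (abs_nonneg _) ((abs_nonneg _).trans hm)
  have h3 : 0 ≤ a ^ 2 * ‖x‖ ^ 2 := by positivity
  linarith

theorem inner_I_mul_self (x : ℂ) : inner ℝ (Complex.I * x) x = 0 := by
  simp only [Complex.inner]
  simp
  ring

namespace IsFastSystem

variable {a R : ℝ} {V V₂ : ℝ → ℝ} {ψ p w w₁ : ℝ → ℂ} {s t : Set ℝ}

theorem mono (h : IsFastSystem a V V₂ ψ p w w₁ s) (hts : t ⊆ s) :
    IsFastSystem a V V₂ ψ p w w₁ t :=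
  ⟨fun z hz => h.1 z (hts hz), fun z hz => h.2 z (hts hz), fun z hz => h.3 z (hts hz),
    fun z hz => h.4 z (hts hz)⟩

theorem continuousOn_psi (h : IsFastSystem a V V₂ ψ p w w₁ s) : ContinuousOn ψ s :=
  fun z hz => (h.1 z hz).continuousAt.continuousWithinAt

theorem continuousOn_p (h : IsFastSystem a V V₂ ψ p w w₁ s) : ContinuousOn p s :=
  fun z hz => (h.2 z hz).continuousAt.continuousWithinAt

theorem continuousOn_w (h : IsFastSystem a V V₂ ψ p w w₁ s) : ContinuousOn w s :=
  fun z hz => (h.3 z hz).continuousAt.continuousWithinAt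

theorem continuousOn_w₁ (h : IsFastSystem a V V₂ ψ p w w₁ s) : ContinuousOn w₁ s :=
  fun z hz => (h.4 z hz).continuousAt.continuousWithinAt

/-- Integrates the derivative of `e^(2θz)(⟨w, w₁⟩ + ⟨iw, w₁⟩)`. The second pairing contributes no
`|w₁|²` because `⟨iw₁, w₁⟩ = 0`. The losses with factors `2θ` (from the weight) and `m` (from `V₂`)
are left to be absorbed by choosing `θ` and `δ` small. -/
theorem energy (h : IsFastSystem a V V₂ ψ p w w₁ (Icc 0 R)) (hR : 0 ≤ R) (hV : Continuous V)
    {m θ : ℝ} (hθ : 0 ≤ θ) (hV₂ : ∀ z ∈ Icc 0 R, |V₂ z| ≤ m) (hwR : w R = 0) :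
    (∫ z in (0 : ℝ)..R, Real.exp (2 * θ * z) * ‖w₁ z‖ ^ 2) +
      (∫ z in (0 : ℝ)..R, Real.exp (2 * θ * z) * (V z * ‖w z‖ ^ 2)) -
      2 * θ * ((∫ z in (0 : ℝ)..R, Real.exp (2 * θ * z) * ‖w z‖ ^ 2) +
        ∫ z in (0 : ℝ)..R, Real.exp (2 * θ * z) * ‖w₁ z‖ ^ 2) -
      m * ((∫ z in (0 : ℝ)..R, Real.exp (2 * θ * z) * ‖w z‖ ^ 2) +
        ∫ z in (0 : ℝ)..R, Real.exp (2 * θ * z) * ‖ψ z‖ ^ 2) ≤ 2 * (‖w 0‖ * ‖w₁ 0‖) := by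
  have c0 := (continuousOn_weighted_sq (θ := θ) h.continuousOn_w).intervalIntegrable_of_Icc
    (μ := volume) hR
  have c1 := (continuousOn_weighted_sq (θ := θ) h.continuousOn_w₁).intervalIntegrable_of_Icc
    (μ := volume) hR
  have c2 := (continuousOn_weighted_sq (θ := θ) h.continuousOn_psi).intervalIntegrable_of_Icc
    (μ := volume) hR
  have hwc := h.continuousOn_w
  have hw₁c := h.continuousOn_w₁
  have hψc := h.continuousOn_psi
  have c3 : ContinuousOn (fun z => Real.exp (2 * θ * z) * (V z * ‖w z‖ ^ 2)) (Icc 0 R) := by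
    have := hV.continuousOn (s := Icc 0 R)
    fun_prop
  have c3' := c3.intervalIntegrable_of_Icc (μ := volume) hR
  have hF : ∀ z ∈ Icc 0 R, HasDerivAt
      (fun z => Real.exp (2 * θ * z) * (inner ℝ (w z) (w₁ z) + inner ℝ (Complex.I * w z) (w₁ z)))
      _ z := fun z hz => hasDerivAt_exp_mul (((h.3 z hz).inner ℝ (h.4 z hz)).add
        (((h.3 z hz).const_mul Complex.I).inner ℝ (h.4 z hz)))
  have key := integral_le_sub_of_hasDerivAt hR hF
    (g := fun z => Real.exp (2 * θ * z) * ‖w₁ z‖ ^ 2 + Real.exp (2 * θ * z) * (V z * ‖w z‖ ^ 2) -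
      2 * θ * (Real.exp (2 * θ * z) * ‖w z‖ ^ 2 + Real.exp (2 * θ * z) * ‖w₁ z‖ ^ 2) -
      m * (Real.exp (2 * θ * z) * ‖w z‖ ^ 2 + Real.exp (2 * θ * z) * ‖ψ z‖ ^ 2))
    (by fun_prop) (fun z hz => by
      have e1 := inner_forcing_lower (w z) (ψ z) a (V z) (V₂ z) m (hV₂ z hz)
      have e2 := inner_I_mul_self (w₁ z)
      have e3 := real_inner_self_eq_norm_sq (w₁ z)
      have e4 : -(‖w z‖ ^ 2 + ‖w₁ z‖ ^ 2) ≤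
          inner ℝ (w z) (w₁ z) + inner ℝ (Complex.I * w z) (w₁ z) := by
        have i1 := (abs_le.1 (abs_two_mul_inner_le one_pos (w z) (w₁ z))).1
        have i2 := (abs_le.1 (abs_two_mul_inner_le one_pos (Complex.I * w z) (w₁ z))).1
        rw [norm_mul, Complex.norm_I, one_mul] at i2
        rw [div_one] at i1 i2
        linarith
      have e5 := mul_le_mul_of_nonneg_left e4 (by positivity : 0 ≤ 2 * θ)
      calc _ = Real.exp (2 * θ * z) * (‖w₁ z‖ ^ 2 + V z * ‖w z‖ ^ 2 -
              2 * θ * (‖w z‖ ^ 2 + ‖w₁ z‖ ^ 2) - m * (‖w z‖ ^ 2 + ‖ψ z‖ ^ 2)) := by ring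
        _ ≤ _ := mul_le_mul_of_nonneg_left (by linarith) (Real.exp_pos _).le)
  rw [intervalIntegral.integral_sub
        (((c1.add c3').sub ((c0.add c1).const_mul _))) ((c0.add c2).const_mul _),
      intervalIntegral.integral_sub (c1.add c3') ((c0.add c1).const_mul _),
      intervalIntegral.integral_add c1 c3', intervalIntegral.integral_const_mul,
      intervalIntegral.integral_const_mul, intervalIntegral.integral_add c0 c1,
      intervalIntegral.integral_add c0 c2] at key
  refine key.trans ?_
  have i1 := (abs_le.1 (abs_real_inner_le_norm (w 0) (w₁ 0))).1
  have i2 := (abs_le.1 (abs_real_inner_le_norm (Complex.I * w 0) (w₁ 0))).1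
  rw [norm_mul, Complex.norm_I, one_mul] at i2
  simp only [hwR, mul_zero, inner_zero_left, Real.exp_zero]
  linarith

end IsFastSystem

/-- Taylor's formula on a unit interval. It controls `w₁`, on which no condition is imposed at the
right endpoint, by `w` and the equation. -/
theorem norm_deriv_le_of_norm_second_deriv_le {f f' f'' : ℝ → ℂ} {x K : ℝ}
    (hf : ∀ z ∈ Icc x (x + 1), HasDerivAt f (f' z) z)
    (hf' : ∀ z ∈ Icc x (x + 1), HasDerivAt f' (f'' z) z)
    (hK : ∀ z ∈ Icc x (x + 1), ‖f'' z‖ ≤ K) : ‖f' x‖ ≤ ‖f (x + 1)‖ + ‖f x‖ + K := by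
  have hx : x ∈ Icc x (x + 1) := ⟨le_rfl, by linarith⟩
  have hx1 : x + 1 ∈ Icc x (x + 1) := ⟨by linarith, le_rfl⟩
  have hK0 : 0 ≤ K := (norm_nonneg _).trans (hK x hx)
  have h1 : ∀ z ∈ Icc x (x + 1), ‖f' z - f' x‖ ≤ K := fun z hz => by
    refine ((convex_Icc x (x + 1)).norm_image_sub_le_of_norm_hasDerivWithin_le
      (fun y hy => (hf' y hy).hasDerivWithinAt) hK hx hz).trans ?_
    refine mul_le_of_le_one_right hK0 ?_
    rw [Real.norm_eq_abs, abs_le]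
    constructor <;> linarith [hz.1, hz.2]
  have h2 := (convex_Icc x (x + 1)).norm_image_sub_le_of_norm_hasDerivWithin_le
    (f := fun y => f y - (y : ℂ) * f' x) (f' := fun y => f' y - f' x) (fun y hy => by
      have := ((hf y hy).sub ((hasDerivAt_id y).ofReal_comp.mul_const (f' x))).hasDerivWithinAt
        (s := Icc x (x + 1))
      simp only [id_eq, Complex.ofReal_one, one_mul] at this
      exact this) h1 hx hx1
  simp only [add_sub_cancel_left, norm_one, mul_one] at h2
  have h3 : f' x = f (x + 1) - f x -
      (f (x + 1) - ((x + 1 : ℝ) : ℂ) * f' x - (f x - (x : ℂ) * f' x)) := by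
    push_cast
    ring
  rw [h3]
  refine (norm_sub_le _ _).trans (add_le_add (norm_sub_le _ _) h2)

theorem exists_uniform_bounds {b M c : ℝ} (hb : 0 < b) (hM : 0 < M) (hc : 0 < c) :
    ∃ θ δ₀ C : ℝ, 0 < θ ∧ θ ≤ 1 ∧ 0 < δ₀ ∧ δ₀ ≤ 1 ∧ 0 < C ∧
      ∀ (δ a R : ℝ) (V V₂ : ℝ → ℝ) (ψ p w w₁ : ℝ → ℂ), 0 < δ → δ ≤ δ₀ → 0 ≤ a → a ≤ θ / 2 →
        1 ≤ R → IsScaledProfile b M c δ V V₂ → IsFastSystem a V V₂ ψ p w w₁ (Icc 0 R) →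
        ψ R = 0 → p R = 0 → w R = 0 →
        (∀ z ∈ Icc 0 R, Real.exp (θ * z) * ‖w z‖ ≤ C * ‖w 0‖ ∧
          Real.exp (θ * z) * ‖ψ z‖ ≤ C * ‖w 0‖ ∧ Real.exp (θ * z) * ‖p z‖ ≤ C * ‖w 0‖) ∧
        ‖w₁ 0‖ ≤ C * ‖w 0‖ := by
  -- `C₀` bounds `∫ |w|²` by the energy `E`, through `weighted_hardy` and `V ≥ c z/(1+z)`. Then `θ`
  -- makes the weight loss at most `E/4`.
  set C₀ : ℝ := 4 / 3 * (1 + 2 / c) with hC₀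
  have hC₀pos : 0 < C₀ := by positivity
  set θ : ℝ := min 1 (1 / (8 * (C₀ + 1))) with hθ
  have hθpos : 0 < θ := by positivity
  have hθ1 : θ ≤ 1 := min_le_left _ _
  have hθ2 : 2 * θ * (C₀ + 1) ≤ 1 / 4 := by
    have : θ ≤ 1 / (8 * (C₀ + 1)) := min_le_right _ _
    rw [le_div_iff₀ (by positivity)] at this
    linarith
  -- `S` is the transport constant for the rate `κ = θ/2`; it is used twice, from `w` to `p` and
  -- from `p` to `ψ`. Then `δ₀` makes the `V₂` loss at most `E/4`.
  set S : ℝ := 1 / (θ / 2) ^ 2 with hS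
  have hSpos : 0 < S := by positivity
  set δ₀ : ℝ := min 1 (1 / (4 * (M * C₀ * (1 + S ^ 2)))) with hδ₀
  have hδ₀2 : M * δ₀ * (C₀ * (1 + S ^ 2)) ≤ 1 / 4 := by
    have : δ₀ ≤ 1 / (4 * (M * C₀ * (1 + S ^ 2))) := min_le_right _ _
    rw [le_div_iff₀ (by positivity)] at this
    linarith
  set D : ℝ := (C₀ + 1) * (1 + 1 / (θ / 2) * (1 + S)) with hD
  have hDpos : 0 < D := by positivity
  set L : ℝ := 3 + b + 2 * M with hL
  have hLpos : 0 < L := by positivity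
  refine ⟨θ, δ₀, 4 * D * L * (1 + L), hθpos, hθ1, by positivity, min_le_left _ _, by positivity,
    ?_⟩
  intro δ a R V V₂ ψ p w w₁ hδ hδδ₀ ha haθ hR hV h hψR hpR hwR
  have hR0 : 0 ≤ R := by linarith
  have hδ1 : δ ≤ 1 := hδδ₀.trans (min_le_left _ _)
  have hV0 : ∀ z ∈ Icc 0 R, 0 ≤ V z := fun z hz => by
    have h0 := hz.1
    exact (by positivity : 0 ≤ c * (z / (1 + z))).trans (hV.lower z h0)
  have energy := h.energy hR0 hV.continuous hθpos.le (fun z hz => hV.bound₂ z hz.1) hwR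
  have hardy := weighted_hardy hθpos.le hR0 h.hasDerivAt_w h.continuousOn_w₁ hwR
  have sqw := fun x hx => weighted_sq_le_integral (x := x) hθpos.le h.hasDerivAt_w
    h.continuousOn_w₁ hwR hx
  obtain ⟨tp, tp'⟩ := weighted_transport (θ := θ) (half_pos hθpos) (by linarith : θ / 2 ≤ θ + a)
    hR0 h.hasDerivAt_p h.continuousOn_w hpR
  obtain ⟨tψ, tψ'⟩ := weighted_transport (θ := θ) (half_pos hθpos) (by linarith : θ / 2 ≤ θ + -a)
    hR0 (u := ψ) (f := p) (fun z hz => (h.hasDerivAt_psi z hz).congr_deriv (by push_cast; ring))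
    h.continuousOn_p hψR
  have c0 := continuousOn_weighted_sq (θ := θ) h.continuousOn_w
  have c1 := continuousOn_weighted_sq (θ := θ) h.continuousOn_w₁
  have c0' := c0.intervalIntegrable_of_Icc (μ := volume) hR0
  have c1' := c1.intervalIntegrable_of_Icc (μ := volume) hR0
  have hwc := h.continuousOn_w
  have c3 : ContinuousOn (fun z => Real.exp (2 * θ * z) * (V z * ‖w z‖ ^ 2)) (Icc 0 R) := by
    have := hV.continuous.continuousOn (s := Icc 0 R)
    fun_prop
  have c3' := c3.intervalIntegrable_of_Icc (μ := volume) hR0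
  set N0 := ∫ z in (0 : ℝ)..R, Real.exp (2 * θ * z) * ‖w z‖ ^ 2 with hN0
  set N1 := ∫ z in (0 : ℝ)..R, Real.exp (2 * θ * z) * ‖w₁ z‖ ^ 2 with hN1
  set NV := ∫ z in (0 : ℝ)..R, Real.exp (2 * θ * z) * (V z * ‖w z‖ ^ 2) with hNV
  set P := ∫ z in (0 : ℝ)..R, Real.exp (2 * θ * z) * ‖p z‖ ^ 2 with hP
  set Nψ := ∫ z in (0 : ℝ)..R, Real.exp (2 * θ * z) * ‖ψ z‖ ^ 2 with hNψ
  have hN1pos : 0 ≤ N1 := intervalIntegral.integral_nonneg hR0 fun z _ => by positivity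
  have hN0pos : 0 ≤ N0 := intervalIntegral.integral_nonneg hR0 fun z _ => by positivity
  have hNVpos : 0 ≤ NV := intervalIntegral.integral_nonneg hR0 fun z hz => by
    have := hV0 z hz
    positivity
  have hNψpos : 0 ≤ Nψ := intervalIntegral.integral_nonneg hR0 fun z _ => by positivity
  have hardy' : 3 / 4 * N0 ≤ N1 + 2 / c * NV := by
    refine hardy.trans ?_
    rw [hN1, hNV, ← intervalIntegral.integral_const_mul, ← intervalIntegral.integral_add c1'
      (c3'.const_mul _)]
    refine intervalIntegral.integral_mono_on hR0 ?_ (c1'.add (c3'.const_mul _)) fun z hz => ?_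
    · refine ContinuousOn.intervalIntegrable_of_Icc hR0 ?_
      have hq : ContinuousOn (fun z : ℝ => z / (1 + z)) (Icc 0 R) := by
        refine ContinuousOn.div (by fun_prop) (by fun_prop) fun z hz => ?_
        have := hz.1
        positivity
      have hw₁c := h.continuousOn_w₁
      fun_prop
    · have h1 := hV.lower z hz.1
      have h2 : z / (1 + z) ≤ 1 / c * V z := by
        rw [one_div, ← div_eq_inv_mul, le_div_iff₀ hc]
        linarith
      calc _ ≤ Real.exp (2 * θ * z) * (‖w₁ z‖ ^ 2 + 2 * (1 / c * V z) * ‖w z‖ ^ 2) := by gcongr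
        _ = _ := by ring
  set E := N1 + NV with hE
  have hEpos : 0 ≤ E := by positivity
  have hN0E : N0 ≤ C₀ * E := by
    have h2 : 0 ≤ 2 / c := by positivity
    have h3 : N1 + 2 / c * NV ≤ (1 + 2 / c) * E := by
      have := mul_nonneg h2 hN1pos
      rw [hE]
      linarith
    rw [hC₀]
    linarith
  have hNψ0 : Nψ ≤ S ^ 2 * N0 := tψ.trans (by
    calc S * P ≤ S * (S * N0) := mul_le_mul_of_nonneg_left tp hSpos.le
      _ = _ := by ring)
  -- Half of `E` survives the two absorptions.
  have hEw : E ≤ 4 * (‖w 0‖ * ‖w₁ 0‖) := by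
    have h1 : 2 * θ * (N0 + N1) ≤ 1 / 4 * E := by
      calc 2 * θ * (N0 + N1) ≤ 2 * θ * (C₀ * E + E) := by gcongr; linarith
        _ = 2 * θ * (C₀ + 1) * E := by ring
        _ ≤ _ := by gcongr
    have h2 : M * δ * (N0 + Nψ) ≤ 1 / 4 * E := by
      calc M * δ * (N0 + Nψ) ≤ M * δ₀ * (C₀ * E + S ^ 2 * (C₀ * E)) := by
            have : Nψ ≤ S ^ 2 * (C₀ * E) := hNψ0.trans (by gcongr)
            have h0 : 0 ≤ C₀ * E + S ^ 2 * (C₀ * E) := by positivity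
            exact mul_le_mul (by gcongr) (add_le_add hN0E this)
              (add_nonneg hN0pos hNψpos) (by positivity)
        _ = M * δ₀ * (C₀ * (1 + S ^ 2)) * E := by ring
        _ ≤ _ := by gcongr
    linarith
  -- `x` dominates `e^(θz)` times each of `|w|`, `|p|`, `|ψ|`.
  set x := Real.sqrt (D * E) with hx
  have hx0 : 0 ≤ x := Real.sqrt_nonneg _
  have hxsq : x ^ 2 = D * E := Real.sq_sqrt (by positivity)
  have hto : ∀ (f : ℝ → ℂ) (z : ℝ), Real.exp (2 * θ * z) * ‖f z‖ ^ 2 ≤ D * E →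
      Real.exp (θ * z) * ‖f z‖ ≤ x := by
    intro f z hf
    refine abs_le_of_sq_le_sq' ?_ hx0 |>.2
    rw [hxsq, mul_pow, ← Real.exp_nat_mul]
    convert! hf using 3
    push_cast
    ring
  have hθ2pos : 0 < 1 / (θ / 2) := by positivity
  have hwx : ∀ z ∈ Icc 0 R, Real.exp (θ * z) * ‖w z‖ ≤ x := fun z hz => hto w z <| by
    refine (sqw z hz).trans ?_
    have h1 : (∫ z in (0 : ℝ)..R, Real.exp (2 * θ * z) * (‖w z‖ ^ 2 + ‖w₁ z‖ ^ 2)) = N0 + N1 := by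
      rw [hN0, hN1, ← intervalIntegral.integral_add c0' c1']
      exact intervalIntegral.integral_congr fun z _ => by ring
    rw [h1]
    calc N0 + N1 ≤ C₀ * E + E := by linarith
      _ = (C₀ + 1) * 1 * E := by ring
      _ ≤ D * E := by
        rw [hD]
        gcongr
        have : 0 ≤ 1 / (θ / 2) * (1 + S) := by positivity
        linarith
  have hpx : ∀ z ∈ Icc 0 R, Real.exp (θ * z) * ‖p z‖ ≤ x := fun z hz => hto p z <| by
    refine (tp' z hz).trans ?_
    calc 1 / (θ / 2) * N0 ≤ 1 / (θ / 2) * (C₀ * E) := by gcongr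
      _ = C₀ * (1 / (θ / 2) * 1) * E := by ring
      _ ≤ D * E := by
        rw [hD]
        gcongr
        · linarith
        · have := mul_pos hθ2pos hSpos
          linarith
  have hψx : ∀ z ∈ Icc 0 R, Real.exp (θ * z) * ‖ψ z‖ ≤ x := fun z hz => hto ψ z <| by
    refine (tψ' z hz).trans ?_
    calc 1 / (θ / 2) * P ≤ 1 / (θ / 2) * (S * (C₀ * E)) := by
          gcongr
          exact tp.trans (by gcongr)
      _ = C₀ * (1 / (θ / 2) * S) * E := by ring
      _ ≤ D * E := by
        rw [hD]
        gcongr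
        · linarith
        · linarith
  have hle : ∀ (f : ℝ → ℂ), (∀ z ∈ Icc 0 R, Real.exp (θ * z) * ‖f z‖ ≤ x) →
      ∀ z ∈ Icc 0 R, ‖f z‖ ≤ x := fun f hf z hz => by
    refine le_trans (le_mul_of_one_le_left (norm_nonneg _) (Real.one_le_exp ?_)) (hf z hz)
    have := hz.1
    positivity
  have hsub : Icc (0 : ℝ) (0 + 1) ⊆ Icc 0 R := Icc_subset_Icc_right (by linarith)
  have hw₁x : ‖w₁ 0‖ ≤ L * x := by
    refine (norm_deriv_le_of_norm_second_deriv_le (K := (1 + b + 2 * M) * x)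
      (fun z hz => h.hasDerivAt_w z (hsub hz))
      (fun z hz => h.hasDerivAt_w₁ z (hsub hz)) fun z hz => ?_).trans ?_
    · have hz' := hsub hz
      have hz1 : z ≤ 1 := by simpa using hz.2
      have hz0 := hz.1
      have hw' := hle w hwx z hz'
      have hψ' := hle ψ hψx z hz'
      have hVz : |V z| ≤ b + M := by
        have h1 := (abs_le.1 (hV.taylor z hz0)).2
        rw [abs_of_nonneg (hV0 z hz')]
        have h2 : b * z ≤ b := mul_le_of_le_one_right hb.le hz1
        have h3 : M * δ * z ^ 2 ≤ M := by
          rw [mul_assoc]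
          exact mul_le_of_le_one_right hM.le (mul_le_one₀ hδ1 (by positivity)
            (pow_le_one₀ hz0 hz1))
        linarith
      have hV₂z : |V₂ z| ≤ M := (hV.bound₂ z hz0).trans (mul_le_of_le_one_right hM.le hδ1)
      calc _ ≤ ‖(a : ℂ) ^ 2 * w z‖ + ‖Complex.I * V z * w z‖ + ‖Complex.I * V₂ z * ψ z‖ :=
            (norm_sub_le _ _).trans (add_le_add_left (norm_add_le _ _) _)
        _ = a ^ 2 * ‖w z‖ + |V z| * ‖w z‖ + |V₂ z| * ‖ψ z‖ := by
            simp
        _ ≤ 1 * x + (b + M) * x + M * x := by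
            gcongr
            exact pow_le_one₀ ha (by linarith)
        _ = _ := by ring
    · have h1 := hle w hwx (0 + 1) (hsub ⟨by norm_num, le_rfl⟩)
      have h2 := hle w hwx 0 ⟨le_rfl, hR0⟩
      rw [hL]
      linarith
  -- The loop closes: `x² = DE ≤ 4D|w(0)||w₁(0)|` and `|w₁(0)| ≤ Lx`, so one factor `x` cancels and
  -- the bound is linear in `|w(0)|`.
  have hxw : x ≤ 4 * D * L * ‖w 0‖ := by
    rcases hx0.eq_or_lt with h0 | h0
    · rw [← h0]; positivity
    · have h1 : x * x ≤ 4 * D * L * ‖w 0‖ * x := by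
        calc x * x = D * E := by rw [← hxsq]; ring
          _ ≤ D * (4 * (‖w 0‖ * (L * x))) := by gcongr; exact hEw.trans (by gcongr)
          _ = _ := by ring
      exact le_of_mul_le_mul_right h1 h0
  have hfin : x ≤ 4 * D * L * (1 + L) * ‖w 0‖ := hxw.trans
    (mul_le_mul_of_nonneg_right (le_mul_of_one_le_right (by positivity) (by linarith))
      (norm_nonneg _))
  refine ⟨fun z hz => ⟨(hwx z hz).trans hfin, (hψx z hz).trans hfin, (hpx z hz).trans hfin⟩,
    hw₁x.trans ?_⟩
  calc L * x ≤ (1 + L) * (4 * D * L * ‖w 0‖) := by gcongr; linarith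
    _ = _ := by ring

/-! ### Shooting and passage to the half-line. -/

/-- The operator-valued fundamental solution of a linear ODE with bounded coefficients. -/
theorem exists_fundamental_solution {E : Type*} [NormedAddCommGroup E] [NormedSpace ℂ E]
    [CompleteSpace E] (A : ℝ → E →L[ℂ] E) (hA : Continuous A) (K : ℝ) (hK : ∀ t, ‖A t‖ ≤ K) :
    ∃ Φ : ℝ → E →L[ℂ] E, Φ 0 = ContinuousLinearMap.id ℂ E ∧
      ∀ t, 0 ≤ t → ∀ (x : E) (l : E →L[ℂ] ℂ),
        HasDerivAt (fun s => l (Φ s x)) (l (A t (Φ t x))) t := by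
  obtain ⟨Φ, h0, hΦ⟩ := exists_hasDerivAt_linear_flow
    (fun t => ((ContinuousLinearMap.compL ℂ E E E) (A t)).restrictScalars ℝ)
    (by
      have h1 : Continuous fun t => (ContinuousLinearMap.compL ℂ E E E) (A t) :=
        (ContinuousLinearMap.compL ℂ E E E).continuous.comp hA
      exact (ContinuousLinearMap.restrictScalarsL ℂ (E →L[ℂ] E) (E →L[ℂ] E) ℝ ℝ).continuous.comp
        h1)
    K (fun t => by
      rw [ContinuousLinearMap.norm_restrictScalars]
      refine le_trans ?_ (hK t)
      refine ContinuousLinearMap.opNorm_le_bound _ (norm_nonneg _) fun x => ?_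
      exact ContinuousLinearMap.opNorm_comp_le _ _)
    (ContinuousLinearMap.id ℂ E)
  refine ⟨Φ, h0, fun t ht x l => ?_⟩
  have h1 := ((l.comp (ContinuousLinearMap.apply ℂ E x)).restrictScalars ℝ).hasFDerivAt
    (x := Φ t) |>.comp_hasDerivAt t (hΦ t ht)
  exact h1

theorem norm_le_of_components (x : ℂ × ℂ × ℂ × ℂ) {r : ℝ} (h1 : ‖x.1‖ ≤ r) (h2 : ‖x.2.1‖ ≤ r)
    (h3 : ‖x.2.2.1‖ ≤ r) (h4 : ‖x.2.2.2‖ ≤ r) : ‖x‖ ≤ r :=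
  norm_prod_le_iff.2 ⟨h1, norm_prod_le_iff.2 ⟨h2, norm_prod_le_iff.2 ⟨h3, h4⟩⟩⟩

/-- A decaying solution on the half-line is obtained as a limit of solutions vanishing at `z = n`,
which exist by a dimension count. -/
theorem exists_solution_of_uniform_bounds {a θ C : ℝ} {V V₂ : ℝ → ℝ} (hV : Continuous V)
    (hV₂ : Continuous V₂) (hbdd : ∃ K, ∀ z, |V z| ≤ K ∧ |V₂ z| ≤ K)
    (H : ∀ (R : ℝ) (ψ p w w₁ : ℝ → ℂ), 1 ≤ R → IsFastSystem a V V₂ ψ p w w₁ (Icc 0 R) →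
        ψ R = 0 → p R = 0 → w R = 0 →
        (∀ z ∈ Icc 0 R, Real.exp (θ * z) * ‖w z‖ ≤ C * ‖w 0‖ ∧
          Real.exp (θ * z) * ‖ψ z‖ ≤ C * ‖w 0‖ ∧ Real.exp (θ * z) * ‖p z‖ ≤ C * ‖w 0‖) ∧
        ‖w₁ 0‖ ≤ C * ‖w 0‖) :
    ∃ ψ p w w₁ : ℝ → ℂ, IsFastSystem a V V₂ ψ p w w₁ (Ici 0) ∧ w 0 = 1 ∧ ‖w₁ 0‖ ≤ C ∧
      ∀ z, 0 ≤ z → ‖w z‖ ≤ C * Real.exp (-(θ * z)) ∧ ‖ψ z‖ ≤ C * Real.exp (-(θ * z)) ∧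
        ‖p z‖ ≤ C * Real.exp (-(θ * z)) := by
  obtain ⟨K, hK⟩ := hbdd
  let π₁ : ℂ × ℂ × ℂ × ℂ →L[ℂ] ℂ := ContinuousLinearMap.fst ℂ ℂ (ℂ × ℂ × ℂ)
  let π₂ : ℂ × ℂ × ℂ × ℂ →L[ℂ] ℂ := (ContinuousLinearMap.fst ℂ ℂ (ℂ × ℂ)).comp
    (ContinuousLinearMap.snd ℂ ℂ (ℂ × ℂ × ℂ))
  let π₃ : ℂ × ℂ × ℂ × ℂ →L[ℂ] ℂ := (ContinuousLinearMap.fst ℂ ℂ ℂ).comp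
    ((ContinuousLinearMap.snd ℂ ℂ (ℂ × ℂ)).comp (ContinuousLinearMap.snd ℂ ℂ (ℂ × ℂ × ℂ)))
  let π₄ : ℂ × ℂ × ℂ × ℂ →L[ℂ] ℂ := (ContinuousLinearMap.snd ℂ ℂ ℂ).comp
    ((ContinuousLinearMap.snd ℂ ℂ (ℂ × ℂ)).comp (ContinuousLinearMap.snd ℂ ℂ (ℂ × ℂ × ℂ)))
  let A₀ : ℂ × ℂ × ℂ × ℂ →L[ℂ] ℂ × ℂ × ℂ × ℂ := (π₂ - (a : ℂ) • π₁).prod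
    (((a : ℂ) • π₂ + π₃).prod (π₄.prod (((a : ℂ) ^ 2) • π₃)))
  let A₁ : ℂ × ℂ × ℂ × ℂ →L[ℂ] ℂ × ℂ × ℂ × ℂ :=
    (0 : ℂ × ℂ × ℂ × ℂ →L[ℂ] ℂ).prod ((0 : ℂ × ℂ × ℂ × ℂ →L[ℂ] ℂ).prod
      ((0 : ℂ × ℂ × ℂ × ℂ →L[ℂ] ℂ).prod (Complex.I • π₃)))
  let A₂ : ℂ × ℂ × ℂ × ℂ →L[ℂ] ℂ × ℂ × ℂ × ℂ :=
    (0 : ℂ × ℂ × ℂ × ℂ →L[ℂ] ℂ).prod ((0 : ℂ × ℂ × ℂ × ℂ →L[ℂ] ℂ).prod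
      ((0 : ℂ × ℂ × ℂ × ℂ →L[ℂ] ℂ).prod (Complex.I • π₁)))
  obtain ⟨Φ, hΦ0, hΦ⟩ := exists_fundamental_solution
    (fun z => A₀ + (V z : ℂ) • A₁ - (V₂ z : ℂ) • A₂) (by fun_prop) (‖A₀‖ + K * ‖A₁‖ + K * ‖A₂‖)
    (fun z => by
      refine (norm_sub_le _ _).trans (add_le_add ((norm_add_le _ _).trans (add_le_add le_rfl ?_)) ?_)
      · rw [norm_smul, Complex.norm_real]
        exact mul_le_mul_of_nonneg_right (hK z).1 (norm_nonneg _)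
      · rw [norm_smul, Complex.norm_real]
        exact mul_le_mul_of_nonneg_right (hK z).2 (norm_nonneg _))
  have hsys : ∀ x, IsFastSystem a V V₂ (fun z => π₁ (Φ z x)) (fun z => π₂ (Φ z x))
      (fun z => π₃ (Φ z x)) (fun z => π₄ (Φ z x)) (Ici 0) := by
    intro x
    refine ⟨fun z hz => (hΦ z hz x π₁).congr_deriv ?_, fun z hz => (hΦ z hz x π₂).congr_deriv ?_,
      fun z hz => (hΦ z hz x π₃).congr_deriv ?_, fun z hz => (hΦ z hz x π₄).congr_deriv ?_⟩
    · simp [π₁, π₂, A₀, A₁, A₂]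
    · simp [π₁, π₂, π₃, A₀, A₁, A₂]
    · simp [π₃, π₄, A₀, A₁, A₂]
    · simp [π₁, π₃, π₄, A₀, A₁, A₂]
      ring
  have hfin : ∀ n : ℕ, ∃ x : ℂ × ℂ × ℂ × ℂ, π₃ x = 1 ∧ ‖x‖ ≤ C ∧
      ∀ z ∈ Icc 0 ((n : ℝ) + 1), ‖π₃ (Φ z x)‖ ≤ C * Real.exp (-(θ * z)) ∧
        ‖π₁ (Φ z x)‖ ≤ C * Real.exp (-(θ * z)) ∧ ‖π₂ (Φ z x)‖ ≤ C * Real.exp (-(θ * z)) := by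
    intro n
    have hR : (0 : ℝ) ≤ (n : ℝ) + 1 := by positivity
    let T : ℂ × ℂ × ℂ × ℂ →ₗ[ℂ] ℂ × ℂ × ℂ :=
      ((π₁.prod (π₂.prod π₃)).comp (Φ ((n : ℝ) + 1))).toLinearMap
    -- Three linear conditions at the right endpoint on a four-dimensional space of initial data.
    have hker : LinearMap.ker T ≠ ⊥ := LinearMap.ker_ne_bot_of_finrank_lt (by simp)
    obtain ⟨y, hy, hy0⟩ := (Submodule.ne_bot_iff _).1 hker
    have hTy : π₁ (Φ ((n : ℝ) + 1) y) = 0 ∧ π₂ (Φ ((n : ℝ) + 1) y) = 0 ∧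
        π₃ (Φ ((n : ℝ) + 1) y) = 0 := by
      have := LinearMap.mem_ker.1 hy
      simpa [T, Prod.ext_iff] using this
    have hbd : ∀ x : ℂ × ℂ × ℂ × ℂ, π₁ (Φ ((n : ℝ) + 1) x) = 0 → π₂ (Φ ((n : ℝ) + 1) x) = 0 →
        π₃ (Φ ((n : ℝ) + 1) x) = 0 → _ := fun x h1 h2 h3 =>
      H ((n : ℝ) + 1) _ _ _ _ (by linarith [n.cast_nonneg (α := ℝ)])
        ((hsys x).mono Icc_subset_Ici_self) h1 h2 h3
    have hnorm : ∀ x : ℂ × ℂ × ℂ × ℂ, π₁ (Φ ((n : ℝ) + 1) x) = 0 → π₂ (Φ ((n : ℝ) + 1) x) = 0 →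
        π₃ (Φ ((n : ℝ) + 1) x) = 0 → ‖x‖ ≤ C * ‖π₃ x‖ := by
      intro x h1 h2 h3
      obtain ⟨e1, e2⟩ := hbd x h1 h2 h3
      obtain ⟨e3, e4, e5⟩ := e1 0 ⟨le_rfl, hR⟩
      simp only [mul_zero, Real.exp_zero, one_mul, hΦ0, ContinuousLinearMap.id_apply] at e2 e3 e4 e5
      exact norm_le_of_components x e4 e5 e3 e2
    -- By the a priori bound `w(0) = 0` would force all initial data to vanish; hence the
    -- normalisation `w(0) = 1`.
    have hy3 : π₃ y ≠ 0 := by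
      intro h
      have := hnorm y hTy.1 hTy.2.1 hTy.2.2
      rw [h, norm_zero, mul_zero] at this
      exact hy0 (norm_le_zero_iff.1 this)
    have hx3 : π₃ ((π₃ y)⁻¹ • y) = 1 := by
      rw [map_smul, smul_eq_mul, inv_mul_cancel₀ hy3]
    have hTx : π₁ (Φ ((n : ℝ) + 1) ((π₃ y)⁻¹ • y)) = 0 ∧
        π₂ (Φ ((n : ℝ) + 1) ((π₃ y)⁻¹ • y)) = 0 ∧ π₃ (Φ ((n : ℝ) + 1) ((π₃ y)⁻¹ • y)) = 0 := by
      simp only [map_smul, hTy.1, hTy.2.1, hTy.2.2, smul_zero, and_self]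
    refine ⟨(π₃ y)⁻¹ • y, hx3, ?_, fun z hz => ?_⟩
    · have := hnorm _ hTx.1 hTx.2.1 hTx.2.2
      rwa [hx3, norm_one, mul_one] at this
    · obtain ⟨e3, e4, e5⟩ := (hbd _ hTx.1 hTx.2.1 hTx.2.2).1 z hz
      have h1 : ‖π₃ (Φ 0 ((π₃ y)⁻¹ • y))‖ = 1 := by
        rw [hΦ0, ContinuousLinearMap.id_apply, hx3, norm_one]
      rw [h1, mul_one, ← le_div_iff₀' (Real.exp_pos _), div_eq_mul_inv, ← Real.exp_neg] at e3 e4 e5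
      exact ⟨e3, e4, e5⟩
  choose x hx1 hxC hxb using hfin
  -- Compactness is only needed for the initial data: each `Φ z` is continuous, so pointwise bounds
  -- pass to the limit.
  obtain ⟨y, -, φ, hφ, hlim⟩ := tendsto_subseq_of_bounded (Metric.isBounded_closedBall (x := 0)
    (r := C)) (x := x) (fun n => by simpa using hxC n)
  have htend : ∀ (l : ℂ × ℂ × ℂ × ℂ →L[ℂ] ℂ) (z : ℝ),
      Tendsto (fun n => l (Φ z (x (φ n)))) atTop (𝓝 (l (Φ z y))) := fun l z =>
    ((l.comp (Φ z)).continuous.tendsto y).comp hlim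
  have hev : ∀ z : ℝ, 0 ≤ z → ∀ᶠ n in atTop, z ∈ Icc 0 ((φ n : ℝ) + 1) := by
    intro z hz
    filter_upwards [(tendsto_natCast_atTop_atTop.comp hφ.tendsto_atTop).eventually_ge_atTop z]
      with n hn
    exact ⟨hz, by simp only [Function.comp_apply] at hn; linarith⟩
  refine ⟨_, _, _, _, hsys y, ?_, ?_, fun z hz => ⟨?_, ?_, ?_⟩⟩
  · refine tendsto_nhds_unique (htend π₃ 0) ?_
    simp only [hΦ0, ContinuousLinearMap.id_apply, hx1]
    exact tendsto_const_nhds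
  · refine le_of_tendsto (htend π₄ 0).norm (Eventually.of_forall fun n => ?_)
    simp only [hΦ0, ContinuousLinearMap.id_apply]
    exact (norm_snd_le _).trans ((norm_snd_le _).trans ((norm_snd_le _).trans (hxC _)))
  · exact le_of_tendsto (htend π₃ z).norm ((hev z hz).mono fun n hn => (hxb (φ n) z hn).1)
  · exact le_of_tendsto (htend π₁ z).norm ((hev z hz).mono fun n hn => (hxb (φ n) z hn).2.1)
  · exact le_of_tendsto (htend π₂ z).norm ((hev z hz).mono fun n hn => (hxb (φ n) z hn).2.2)

/-- Decaying solutions of the rescaled Orr-Sommerfeld system, with bounds uniform in the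
parameters. -/
theorem exists_fast_solution {b M c : ℝ} (hb : 0 < b) (hM : 0 < M) (hc : 0 < c) :
    ∃ θ δ₀ C : ℝ, 0 < θ ∧ θ ≤ 1 ∧ 0 < δ₀ ∧ δ₀ ≤ 1 ∧ 0 < C ∧
      ∀ (δ a : ℝ) (V V₂ : ℝ → ℝ), 0 < δ → δ ≤ δ₀ → 0 ≤ a → a ≤ θ / 2 →
        IsScaledProfile b M c δ V V₂ →
        ∃ ψ p w w₁ : ℝ → ℂ, IsFastSystem a V V₂ ψ p w w₁ (Ici 0) ∧ w 0 = 1 ∧ ‖w₁ 0‖ ≤ C ∧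
          ∀ z, 0 ≤ z → ‖w z‖ ≤ C * Real.exp (-(θ * z)) ∧ ‖ψ z‖ ≤ C * Real.exp (-(θ * z)) ∧
            ‖p z‖ ≤ C * Real.exp (-(θ * z)) := by
  obtain ⟨θ, δ₀, C, h1, h2, h3, h4, h5, H⟩ := exists_uniform_bounds hb hM hc
  refine ⟨θ, δ₀, C, h1, h2, h3, h4, h5, fun δ a V V₂ hδ hδ₀ ha haθ hV => ?_⟩
  exact exists_solution_of_uniform_bounds hV.continuous hV.continuous₂ hV.bounded
    fun R ψ p w w₁ hR h e1 e2 e3 => H δ a R V V₂ ψ p w w₁ hδ hδ₀ ha haθ hR hV h e1 e2 e3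

/-! ### Ray integrals as solutions of an inhomogeneous Airy equation. -/

/-- The moments `∫₀^∞ τ^k exp (-z d τ - m τ³) dτ` along a ray of direction `d`. -/
noncomputable def rayIntegral (m : ℝ) (d : ℂ) (k : ℕ) (z : ℝ) : ℂ :=
  ∫ τ in Ioi (0 : ℝ), (τ : ℂ) ^ k * Complex.exp (-(z * d * τ) - m * τ ^ 3)

/-- The moments `∫₀^∞ τ^k exp (-m τ³) dτ`. -/
noncomputable def cubicMoment (m : ℝ) (k : ℕ) : ℝ :=
  ∫ τ in Ioi (0 : ℝ), τ ^ k * Real.exp (-(m * τ ^ 3))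

section Ray

variable {m : ℝ} {d : ℂ}

theorem integrableOn_pow_mul_exp_neg_cube (hm : 0 < m) (k : ℕ) :
    IntegrableOn (fun τ : ℝ => τ ^ k * Real.exp (-(m * τ ^ 3))) (Ioi 0) := by
  have h := integrableOn_rpow_mul_exp_neg_mul_rpow (p := 3) (s := k) (b := m)
    (by linarith [k.cast_nonneg (α := ℝ)]) (by norm_num) hm
  refine h.congr_fun (fun τ _ => ?_) measurableSet_Ioi
  simp only [Real.rpow_natCast, neg_mul]
  norm_cast

theorem cubicMoment_pos (hm : 0 < m) (k : ℕ) : 0 < cubicMoment m k := by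
  refine (setIntegral_pos_iff_support_of_nonneg_ae ?_ (integrableOn_pow_mul_exp_neg_cube hm k)).2 ?_
  · filter_upwards [ae_restrict_mem measurableSet_Ioi] with τ (hτ : 0 < τ)
    positivity
  · have : Function.support (fun τ : ℝ => τ ^ k * Real.exp (-(m * τ ^ 3))) ∩ Ioi 0 = Ioi 0 := by
      refine inter_eq_right.2 fun τ (hτ : 0 < τ) => ?_
      rw [Function.mem_support]
      positivity
    rw [this]
    simp

theorem cubicMoment_zero (hm : 0 < m) :
    cubicMoment m 0 = m ^ (-(1 / 3) : ℝ) * (1 / 3 * Real.Gamma (1 / 3)) := by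
  have h := integral_exp_neg_mul_rpow (p := 3) (b := m) (by norm_num) hm
  rw [← Real.Gamma_add_one (by norm_num), ← neg_div, ← h, cubicMoment]
  refine setIntegral_congr_fun measurableSet_Ioi fun τ _ => ?_
  simp only [pow_zero, one_mul, neg_mul]
  norm_cast

/-- The cubic term alone gives integrability, so a purely imaginary direction such as `d = i` is
admissible. -/
theorem norm_ray_integrand_le (hd : 0 ≤ d.re) (k : ℕ) {z τ : ℝ} (hz : 0 ≤ z) (hτ : 0 < τ) :
    ‖(τ : ℂ) ^ k * Complex.exp (-(z * d * τ) - m * τ ^ 3)‖ ≤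
      τ ^ k * Real.exp (-(m * τ ^ 3)) := by
  rw [norm_mul, norm_pow, Complex.norm_real, Real.norm_of_nonneg hτ.le, Complex.norm_exp]
  refine mul_le_mul_of_nonneg_left (Real.exp_le_exp.2 ?_) (by positivity)
  have h1 : (-((z : ℂ) * d * τ) - m * τ ^ 3).re = -(z * d.re * τ) - m * τ ^ 3 := by
    rw [← Complex.ofReal_pow, mul_right_comm, ← Complex.ofReal_mul, ← Complex.ofReal_mul,
      Complex.sub_re, Complex.neg_re, Complex.re_ofReal_mul, Complex.ofReal_re]
    ring
  rw [h1]
  have : 0 ≤ z * d.re * τ := by positivity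
  linarith

theorem continuous_ray_integrand (k : ℕ) (z : ℝ) :
    Continuous fun τ : ℝ => (τ : ℂ) ^ k * Complex.exp (-(z * d * τ) - m * τ ^ 3) := by
  fun_prop

theorem integrableOn_ray_integrand (hm : 0 < m) (hd : 0 ≤ d.re) (k : ℕ) {z : ℝ} (hz : 0 ≤ z) :
    IntegrableOn (fun τ : ℝ => (τ : ℂ) ^ k * Complex.exp (-(z * d * τ) - m * τ ^ 3)) (Ioi 0) := by
  refine (integrableOn_pow_mul_exp_neg_cube hm k).mono'
    (continuous_ray_integrand k z).aestronglyMeasurable ?_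
  filter_upwards [ae_restrict_mem measurableSet_Ioi] with τ hτ
  exact norm_ray_integrand_le hd k hz hτ

theorem norm_rayIntegral_le (hm : 0 < m) (hd : 0 ≤ d.re) (k : ℕ) {z : ℝ} (hz : 0 ≤ z) :
    ‖rayIntegral m d k z‖ ≤ cubicMoment m k := by
  refine norm_integral_le_of_norm_le (integrableOn_pow_mul_exp_neg_cube hm k) ?_
  filter_upwards [ae_restrict_mem measurableSet_Ioi] with τ hτ
  exact norm_ray_integrand_le hd k hz hτ

theorem rayIntegral_at_zero (k : ℕ) : rayIntegral m d k 0 = cubicMoment m k := by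
  rw [rayIntegral, cubicMoment, ← integral_complex_ofReal]
  refine setIntegral_congr_fun measurableSet_Ioi fun τ _ => ?_
  simp

theorem continuousOn_rayIntegral (hm : 0 < m) (hd : 0 ≤ d.re) (k : ℕ) :
    ContinuousOn (rayIntegral m d k) (Ici 0) := by
  refine continuousOn_of_dominated (bound := fun τ => τ ^ k * Real.exp (-(m * τ ^ 3)))
    (fun z _ => (continuous_ray_integrand k z).aestronglyMeasurable) (fun z hz => ?_)
    (integrableOn_pow_mul_exp_neg_cube hm k) (Eventually.of_forall fun τ => by fun_prop)
  filter_upwards [ae_restrict_mem measurableSet_Ioi] with τ hτ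
  exact norm_ray_integrand_le hd k hz hτ

theorem hasDerivAt_rayIntegral (hm : 0 < m) (hd : 0 ≤ d.re) (k : ℕ) {z : ℝ} (hz : 0 < z) :
    HasDerivAt (rayIntegral m d k) (-(d * rayIntegral m d (k + 1) z)) z := by
  have h := hasDerivAt_integral_of_dominated_loc_of_deriv_le (μ := volume.restrict (Ioi (0 : ℝ)))
    (F := fun (z : ℝ) (τ : ℝ) => (τ : ℂ) ^ k * Complex.exp (-(z * d * τ) - m * τ ^ 3))
    (F' := fun (z : ℝ) (τ : ℝ) =>
      -(d * ((τ : ℂ) ^ (k + 1) * Complex.exp (-(z * d * τ) - m * τ ^ 3))))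
    (bound := fun τ => ‖d‖ * (τ ^ (k + 1) * Real.exp (-(m * τ ^ 3)))) (x₀ := z) (s := Ioi 0)
    (Ioi_mem_nhds hz)
    (Eventually.of_forall fun z => (continuous_ray_integrand k z).aestronglyMeasurable)
    (integrableOn_ray_integrand hm hd k hz.le)
    ((continuous_ray_integrand (k + 1) z).const_mul d).neg.aestronglyMeasurable
    (by
      filter_upwards [ae_restrict_mem measurableSet_Ioi] with τ hτ x hx
      rw [norm_neg, norm_mul]
      exact mul_le_mul_of_nonneg_left (norm_ray_integrand_le hd _ (le_of_lt hx) hτ)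
        (norm_nonneg _))
    ((integrableOn_pow_mul_exp_neg_cube hm (k + 1)).const_mul _)
    (Eventually.of_forall fun τ x _ => by
      have h1 : HasDerivAt (fun x : ℝ => -((x : ℂ) * d * τ) - m * (τ : ℂ) ^ 3) (-(1 * d * τ)) x :=
        ((((hasDerivAt_id x).ofReal_comp).mul_const d).mul_const (τ : ℂ)).neg.sub_const _
      exact (h1.cexp.const_mul _).congr_deriv (by ring))
  have h2 := h.2
  rw [integral_neg, integral_const_mul] at h2
  exact h2

/-- Integrates the `τ`-derivative of the exponential. Together with the differentiation rule in `z`,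
for `m = 1/(3b)` and `d³ = -i` this says that `u = d J₀` satisfies `u'' = ibzu - ib`. -/
theorem rayIntegral_recurrence (hm : 0 < m) (hd : 0 ≤ d.re) {z : ℝ} (hz : 0 ≤ z) :
    z * d * rayIntegral m d 0 z + 3 * m * rayIntegral m d 2 z = 1 := by
  have hderiv : ∀ τ ∈ Ici (0 : ℝ), HasDerivAt
      (fun τ : ℝ => Complex.exp (-(z * d * τ) - m * τ ^ 3))
      (-(z * d * ((τ : ℂ) ^ 0 * Complex.exp (-(z * d * τ) - m * τ ^ 3)) +
        3 * m * ((τ : ℂ) ^ 2 * Complex.exp (-(z * d * τ) - m * τ ^ 3)))) τ := by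
    intro τ _
    have h1 : HasDerivAt (fun τ : ℝ => -(z * d * τ) - m * (τ : ℂ) ^ 3)
        (-(z * d * 1) - m * (3 * (τ : ℂ) ^ 2 * 1)) τ := by
      have e := (hasDerivAt_id τ).ofReal_comp
      exact ((e.const_mul (z * d)).neg).sub ((e.fun_pow 3).const_mul (m : ℂ))
    exact h1.cexp.congr_deriv (by ring)
  have i0 := integrableOn_ray_integrand hm hd 0 hz
  have i2 := integrableOn_ray_integrand hm hd 2 hz
  have hlim : Tendsto (fun τ : ℝ => Complex.exp (-(z * d * τ) - m * τ ^ 3)) atTop (𝓝 0) := by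
    have h0 : Tendsto (fun τ : ℝ => Real.exp (-(m * τ ^ 3))) atTop (𝓝 0) :=
      Real.tendsto_exp_neg_atTop_nhds_zero.comp
        ((tendsto_pow_atTop (by norm_num)).const_mul_atTop hm)
    refine squeeze_zero_norm' ?_ h0
    filter_upwards [eventually_gt_atTop 0] with τ hτ
    simpa using norm_ray_integrand_le (m := m) hd 0 hz hτ
  have key := integral_Ioi_of_hasDerivAt_of_tendsto' hderiv
    ((i0.const_mul (z * d)).add (i2.const_mul (3 * (m : ℂ)))).neg hlim
  rw [integral_neg, integral_add (i0.const_mul _) (i2.const_mul _), integral_const_mul,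
    integral_const_mul] at key
  simp only [Complex.ofReal_zero, mul_zero, neg_zero, ne_eq, OfNat.ofNat_ne_zero,
    not_false_eq_true, zero_pow, sub_zero, Complex.exp_zero, zero_sub, neg_inj] at key
  exact key

end Ray

/-! ### Consequences of exponential decay. -/

theorem integrableOn_const_mul_exp_neg {K σ : ℝ} (hσ : 0 < σ) :
    IntegrableOn (fun z : ℝ => K * Real.exp (-(σ * z))) (Ioi 0) := by
  have := (exp_neg_integrableOn_Ioi 0 hσ).const_mul K
  simp only [neg_mul] at this
  exact this

theorem integrableOn_of_exp_decay {f : ℝ → ℂ} {K σ : ℝ} (hσ : 0 < σ) (hf : ContinuousOn f (Ici 0))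
    (hb : ∀ z, 0 ≤ z → ‖f z‖ ≤ K * Real.exp (-(σ * z))) : IntegrableOn f (Ioi 0) := by
  have h1 := integrableOn_const_mul_exp_neg (K := K) hσ
  refine h1.mono' ((hf.mono Ioi_subset_Ici_self).aestronglyMeasurable measurableSet_Ioi) ?_
  filter_upwards [ae_restrict_mem measurableSet_Ioi] with z hz
  exact hb z (le_of_lt hz)

theorem norm_integral_le_of_exp_decay {f : ℝ → ℂ} {K σ : ℝ} (hσ : 0 < σ)
    (hb : ∀ z, 0 ≤ z → ‖f z‖ ≤ K * Real.exp (-(σ * z))) :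
    ‖∫ z in Ioi (0 : ℝ), f z‖ ≤ K / σ := by
  have h1 := integrableOn_const_mul_exp_neg (K := K) hσ
  refine (norm_integral_le_of_norm_le h1 ?_).trans (le_of_eq ?_)
  · filter_upwards [ae_restrict_mem measurableSet_Ioi] with z hz
    exact hb z (le_of_lt hz)
  · have := integral_exp_mul_Ioi (neg_lt_zero.2 hσ) 0
    rw [integral_const_mul]
    simp only [neg_mul, mul_zero, Real.exp_zero] at this
    rw [this]
    field_simp

theorem tendsto_zero_of_exp_decay {f : ℝ → ℂ} {K σ : ℝ} (hσ : 0 < σ)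
    (hb : ∀ z, 0 ≤ z → ‖f z‖ ≤ K * Real.exp (-(σ * z))) : Tendsto f atTop (𝓝 0) := by
  have h0 : Tendsto (fun z : ℝ => K * Real.exp (-(σ * z))) atTop (𝓝 0) := by
    have := (Real.tendsto_exp_neg_atTop_nhds_zero.comp
      (tendsto_id.const_mul_atTop hσ)).const_mul K
    simpa using this
  refine squeeze_zero_norm' ?_ h0
  filter_upwards [eventually_ge_atTop 0] with z hz
  exact hb z hz

/-- Half of the rate pays for the polynomial: cube `1 + z ≤ (6/θ) e^(θz/6)`. -/
theorem pow_mul_exp_neg_le {θ : ℝ} (hθ : 0 < θ) (hθ1 : θ ≤ 1) {z : ℝ} (hz : 0 ≤ z) {k : ℕ}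
    (hk : k ≤ 3) :
    z ^ k * Real.exp (-(θ * z)) ≤ (6 / θ) ^ 3 * Real.exp (-(θ / 2 * z)) := by
  have h1 : 1 + z ≤ 6 / θ * Real.exp (θ / 6 * z) := by
    have h2 := Real.add_one_le_exp (θ / 6 * z)
    have h3 : 1 ≤ 6 / θ := by rw [le_div_iff₀ hθ]; linarith
    calc 1 + z ≤ 6 / θ * 1 + z := by linarith
      _ = 6 / θ * (θ / 6 * z + 1) := by field_simp; ring
      _ ≤ _ := by gcongr
  have h2 : z ^ k ≤ (6 / θ) ^ 3 * Real.exp (θ / 2 * z) := by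
    calc z ^ k ≤ (1 + z) ^ k := by gcongr; linarith
      _ ≤ (1 + z) ^ 3 := pow_le_pow_right₀ (by linarith) hk
      _ ≤ (6 / θ * Real.exp (θ / 6 * z)) ^ 3 := by gcongr
      _ = _ := by
        rw [mul_pow, ← Real.exp_nat_mul]
        congr 2
        push_cast
        ring
  calc z ^ k * Real.exp (-(θ * z)) ≤ (6 / θ) ^ 3 * Real.exp (θ / 2 * z) * Real.exp (-(θ * z)) := by
        gcongr
    _ = _ := by
      rw [mul_assoc, ← Real.exp_add]
      congr 2
      ring

/-! ### Integral identities for decaying solutions. -/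

/-- The hypotheses on a normalised decaying solution, with an exponential rate `θ`. -/
structure IsDecayingSolution (a θ C : ℝ) (V V₂ : ℝ → ℝ) (ψ p w w₁ : ℝ → ℂ) : Prop where
  system : IsFastSystem a V V₂ ψ p w w₁ (Ici 0)
  w_zero : w 0 = 1
  w_bound : ∀ z, 0 ≤ z → ‖w z‖ ≤ C * Real.exp (-(θ * z))
  psi_bound : ∀ z, 0 ≤ z → ‖ψ z‖ ≤ C * Real.exp (-(θ * z))
  p_bound : ∀ z, 0 ≤ z → ‖p z‖ ≤ C * Real.exp (-(θ * z))

/-- The second derivative of `w`, minus its leading part `i b z w`. -/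
noncomputable def airyDefect (a b : ℝ) (V V₂ : ℝ → ℝ) (ψ w : ℝ → ℂ) (z : ℝ) : ℂ :=
  a ^ 2 * w z + Complex.I * ((V z - b * z : ℝ) : ℂ) * w z - Complex.I * V₂ z * ψ z

namespace IsDecayingSolution

variable {a b M c δ θ C : ℝ} {V V₂ : ℝ → ℝ} {ψ p w w₁ : ℝ → ℂ}

theorem norm_pow_mul_le {f : ℝ → ℂ} (hθ : 0 < θ) (hθ1 : θ ≤ 1) (hC : 0 < C)
    (hf : ∀ z, 0 ≤ z → ‖f z‖ ≤ C * Real.exp (-(θ * z))) {k : ℕ} (hk : k ≤ 3) {z : ℝ} (hz : 0 ≤ z) :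
    z ^ k * ‖f z‖ ≤ C * (6 / θ) ^ 3 * Real.exp (-(θ / 2 * z)) := by
  calc z ^ k * ‖f z‖ ≤ z ^ k * (C * Real.exp (-(θ * z))) := by gcongr; exact hf z hz
    _ = C * (z ^ k * Real.exp (-(θ * z))) := by ring
    _ ≤ C * ((6 / θ) ^ 3 * Real.exp (-(θ / 2 * z))) :=
        mul_le_mul_of_nonneg_left (pow_mul_exp_neg_le hθ hθ1 hz hk) hC.le
    _ = _ := by ring

/-- Each term carries a factor `a² ≤ a` or `δ`; the factor `z²` from the Taylor error is absorbed by
lowering the rate to `θ/2`. -/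
theorem norm_airyDefect_le (h : IsDecayingSolution a θ C V V₂ ψ p w w₁)
    (hV : IsScaledProfile b M c δ V V₂) (hθ : 0 < θ) (hθ1 : θ ≤ 1) (hC : 0 < C) (hM : 0 < M)
    (hδ : 0 < δ) (ha : 0 ≤ a) (ha1 : a ≤ 1) {z : ℝ} (hz : 0 ≤ z) :
    ‖airyDefect a b V V₂ ψ w z‖ ≤
      (1 + 2 * M) * (δ + a) * (C * (6 / θ) ^ 3) * Real.exp (-(θ / 2 * z)) := by
  have h0 := norm_pow_mul_le hθ hθ1 hC h.w_bound (k := 0) (by norm_num) hz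
  have h2 := norm_pow_mul_le hθ hθ1 hC h.w_bound (k := 2) (by norm_num) hz
  have h3 := norm_pow_mul_le hθ hθ1 hC h.psi_bound (k := 0) (by norm_num) hz
  rw [pow_zero, one_mul] at h0 h3
  set Q := C * (6 / θ) ^ 3 * Real.exp (-(θ / 2 * z)) with hQ
  have hQ0 : 0 ≤ Q := by positivity
  calc _ ≤ ‖(a : ℂ) ^ 2 * w z‖ + ‖Complex.I * ((V z - b * z : ℝ) : ℂ) * w z‖ +
        ‖Complex.I * V₂ z * ψ z‖ :=
        (norm_sub_le _ _).trans (add_le_add_left (norm_add_le _ _) _)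
    _ = a ^ 2 * ‖w z‖ + |V z - b * z| * ‖w z‖ + |V₂ z| * ‖ψ z‖ := by
        simp only [norm_mul, Complex.norm_I, one_mul, norm_pow, Complex.norm_real,
          Real.norm_eq_abs, sq_abs]
    _ ≤ a * Q + M * δ * Q + M * δ * Q := by
        have e1 : a ^ 2 ≤ a := by nlinarith
        have e2 : |V z - b * z| * ‖w z‖ ≤ M * δ * Q := by
          calc _ ≤ M * δ * z ^ 2 * ‖w z‖ := by gcongr; exact hV.taylor z hz
            _ = M * δ * (z ^ 2 * ‖w z‖) := by ring
            _ ≤ _ := by gcongr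
        have e3 := hV.bound₂ z hz
        gcongr
    _ ≤ (1 + 2 * M) * (δ + a) * Q := by
        have e1 : 0 ≤ δ * Q := by positivity
        have e2 : 0 ≤ M * a * Q := by positivity
        linarith
    _ = _ := by rw [hQ]; ring

theorem continuousOn_airyDefect (h : IsDecayingSolution a θ C V V₂ ψ p w w₁)
    (hV : IsScaledProfile b M c δ V V₂) :
    ContinuousOn (airyDefect a b V V₂ ψ w) (Ici 0) := by
  have h1 := h.system.continuousOn_w
  have h2 := h.system.continuousOn_psi
  have h3 := hV.continuous
  have h4 := hV.continuous₂
  have h5 : Continuous fun z => ((V z - b * z : ℝ) : ℂ) := by fun_prop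
  have h6 : Continuous fun z => ((V₂ z : ℝ) : ℂ) := by fun_prop
  have h5' := h5.continuousOn (s := Ici 0)
  have h6' := h6.continuousOn (s := Ici 0)
  unfold airyDefect
  fun_prop

theorem hasDerivAt_w₁' (h : IsDecayingSolution a θ C V V₂ ψ p w w₁) {z : ℝ} (hz : 0 ≤ z) :
    HasDerivAt w₁ (Complex.I * b * (z * w z) + airyDefect a b V V₂ ψ w z) z :=
  (h.system.hasDerivAt_w₁ z hz).congr_deriv (by
    unfold airyDefect
    push_cast
    ring)

/-- Interpolation on `[z, z + 1]`. The size of `K` is immaterial: the bound serves for limits at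
infinity and membership in `H⁴`. -/
theorem exists_w₁_bound (h : IsDecayingSolution a θ C V V₂ ψ p w w₁)
    (hV : IsScaledProfile b M c δ V V₂) (hb : 0 < b) (hθ : 0 < θ) (hθ1 : θ ≤ 1) (hC : 0 < C)
    (hM : 0 < M) (hδ : 0 < δ) (ha : 0 ≤ a) (ha1 : a ≤ 1) :
    ∃ K, ∀ z, 0 ≤ z → ‖w₁ z‖ ≤ K * Real.exp (-(θ / 2 * z)) := by
  set Q := C * (6 / θ) ^ 3 with hQ
  refine ⟨Q + Q + (b * Q + (1 + 2 * M) * (δ + a) * Q), fun z hz => ?_⟩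
  have hQ0 : 0 ≤ Q := by positivity
  have hmono : ∀ y ∈ Icc z (z + 1), Real.exp (-(θ / 2 * y)) ≤ Real.exp (-(θ / 2 * z)) := by
    intro y hy
    have := hy.1
    gcongr
  refine (norm_deriv_le_of_norm_second_deriv_le
    (K := (b * Q + (1 + 2 * M) * (δ + a) * Q) * Real.exp (-(θ / 2 * z)))
    (fun y hy => h.system.hasDerivAt_w y (hz.trans hy.1))
    (fun y hy => h.hasDerivAt_w₁' (b := b) (hz.trans hy.1)) fun y hy => ?_).trans ?_
  · have hy0 : 0 ≤ y := hz.trans hy.1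
    have e1 := norm_pow_mul_le hθ hθ1 hC h.w_bound (k := 1) (by norm_num) hy0
    have e2 := h.norm_airyDefect_le hV hθ hθ1 hC hM hδ ha ha1 hy0
    rw [pow_one] at e1
    calc _ ≤ ‖Complex.I * b * (y * w y)‖ + ‖airyDefect a b V V₂ ψ w y‖ := norm_add_le _ _
      _ = b * (y * ‖w y‖) + ‖airyDefect a b V V₂ ψ w y‖ := by
        simp [abs_of_pos hb, abs_of_nonneg hy0]
      _ ≤ b * (Q * Real.exp (-(θ / 2 * y))) +
          (1 + 2 * M) * (δ + a) * Q * Real.exp (-(θ / 2 * y)) := by gcongr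
      _ = (b * Q + (1 + 2 * M) * (δ + a) * Q) * Real.exp (-(θ / 2 * y)) := by ring
      _ ≤ _ := by
        gcongr
        exact hy.1
  · have e1 := norm_pow_mul_le hθ hθ1 hC h.w_bound (k := 0) (by norm_num)
      (by linarith : 0 ≤ z + 1)
    have e2 := norm_pow_mul_le hθ hθ1 hC h.w_bound (k := 0) (by norm_num) hz
    rw [pow_zero, one_mul] at e1 e2
    have e3 : ‖w (z + 1)‖ ≤ Q * Real.exp (-(θ / 2 * z)) := by
      refine e1.trans (mul_le_mul_of_nonneg_left (hmono _ ⟨by linarith, le_rfl⟩) hQ0)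
    linarith

/-- Testing the equation for `w` against a ray integral, a solution of an inhomogeneous Airy
equation. -/
theorem wronskian_identity (h : IsDecayingSolution a θ C V V₂ ψ p w w₁)
    (hV : IsScaledProfile b M c δ V V₂) (hb : 0 < b) (hθ : 0 < θ) (hθ1 : θ ≤ 1) (hC : 0 < C)
    (hM : 0 < M) (hδ : 0 < δ) (ha : 0 ≤ a) (ha1 : a ≤ 1) {d : ℂ} (hd : 0 ≤ d.re)
    (hd3 : d ^ 3 = -Complex.I) :
    Complex.I * b * ∫ z in Ioi (0 : ℝ), w z =
      -d ^ 2 * cubicMoment (1 / (3 * b)) 1 - d * w₁ 0 * cubicMoment (1 / (3 * b)) 0 -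
      ∫ z in Ioi (0 : ℝ), d * rayIntegral (1 / (3 * b)) d 0 z * airyDefect a b V V₂ ψ w z := by
  set m : ℝ := 1 / (3 * b) with hm
  have hmpos : 0 < m := by positivity
  set J := rayIntegral m d with hJ
  have hσ : 0 < θ / 2 := half_pos hθ
  obtain ⟨K, hK⟩ := h.exists_w₁_bound hV hb hθ hθ1 hC hM hδ ha ha1
  have hJc : ∀ k, ContinuousOn (J k) (Ici 0) := fun k => continuousOn_rayIntegral hmpos hd k
  have hJb : ∀ k z, 0 ≤ z → ‖J k z‖ ≤ cubicMoment m k :=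
    fun k z hz => norm_rayIntegral_le hmpos hd k hz
  have hwc := h.system.continuousOn_w
  have hw₁c := h.system.continuousOn_w₁
  have hgc := h.continuousOn_airyDefect hV (b := b)
  have hwb : ∀ z, 0 ≤ z → ‖w z‖ ≤ C * (6 / θ) ^ 3 * Real.exp (-(θ / 2 * z)) := fun z hz => by
    simpa using norm_pow_mul_le hθ hθ1 hC h.w_bound (k := 0) (by norm_num) hz
  have hJ2 : ∀ z, 0 ≤ z → J 2 z = b - b * (z * d * J 0 z) := by
    intro z hz
    have h1 := rayIntegral_recurrence hmpos hd hz
    have h2 : (3 : ℂ) * m = 1 / b := by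
      rw [hm]
      push_cast
      have : (b : ℂ) ≠ 0 := by exact_mod_cast hb.ne'
      field_simp
    rw [h2] at h1
    have : (b : ℂ) ≠ 0 := by exact_mod_cast hb.ne'
    field_simp at h1
    linear_combination h1
  -- With `u = d J₀` this is the Wronskian `w u' - w₁ u`; the terms `ibzwu` cancel in its
  -- derivative, leaving `-ibw` and the defect tested against `u`.
  have hderiv : ∀ z ∈ Ioi (0 : ℝ), HasDerivAt
      (fun z => w z * (-d ^ 2 * J 1 z) - w₁ z * (d * J 0 z))
      (-(Complex.I * b * w z) - d * J 0 z * airyDefect a b V V₂ ψ w z) z := by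
    intro z hz
    have hz0 : 0 ≤ z := le_of_lt hz
    have e0 := (hasDerivAt_rayIntegral hmpos hd 0 hz).const_mul d
    have e1 := (hasDerivAt_rayIntegral hmpos hd 1 hz).const_mul (-d ^ 2)
    refine (((h.system.hasDerivAt_w z hz0).mul e1).sub
      ((h.hasDerivAt_w₁' (b := b) hz0).mul e0)).congr_deriv ?_
    have e2 := hJ2 z hz0
    simp only [← hJ] at e2 ⊢
    norm_num
    rw [e2]
    linear_combination (w z * (b - b * (z * d * J 0 z))) * hd3
  have hint1 : IntegrableOn (fun z => -(Complex.I * b * w z)) (Ioi 0) :=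
    ((integrableOn_of_exp_decay hσ hwc hwb).const_mul _).neg
  have hint2 : IntegrableOn (fun z => d * J 0 z * airyDefect a b V V₂ ψ w z) (Ioi 0) := by
    have hJ0 := hJc 0
    refine integrableOn_of_exp_decay (K := ‖d‖ * cubicMoment m 0 *
      ((1 + 2 * M) * (δ + a) * (C * (6 / θ) ^ 3))) hσ (by fun_prop) fun z hz => ?_
    rw [norm_mul, norm_mul, mul_assoc (‖d‖ * cubicMoment m 0)]
    have := hJb 0 z hz
    have := (cubicMoment_pos hmpos 0).le
    have := h.norm_airyDefect_le hV hθ hθ1 hC hM hδ ha ha1 hz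
    gcongr
  have hlim : Tendsto (fun z => w z * (-d ^ 2 * J 1 z) - w₁ z * (d * J 0 z)) atTop (𝓝 0) := by
    refine tendsto_zero_of_exp_decay (K := C * (6 / θ) ^ 3 * (‖d‖ ^ 2 * cubicMoment m 1) +
      K * (‖d‖ * cubicMoment m 0)) hσ fun z hz => ?_
    refine (norm_sub_le _ _).trans ?_
    rw [norm_mul, norm_mul, norm_mul, norm_mul, norm_neg, norm_pow, add_mul]
    have i0 := hJb 0 z hz
    have i1 := hJb 1 z hz
    have i2 := hwb z hz
    have i3 := hK z hz
    have i4 : 0 ≤ K * Real.exp (-(θ / 2 * z)) := (norm_nonneg _).trans i3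
    refine add_le_add ?_ ?_
    · calc _ ≤ (C * (6 / θ) ^ 3 * Real.exp (-(θ / 2 * z))) * (‖d‖ ^ 2 * cubicMoment m 1) := by
            gcongr
        _ = _ := by ring
    · calc _ ≤ (K * Real.exp (-(θ / 2 * z))) * (‖d‖ * cubicMoment m 0) := by
            gcongr
        _ = _ := by ring
  -- The derivative of `J` is available for `z > 0` only, so the endpoint is reached by one-sided
  -- continuity.
  have hcont : ContinuousWithinAt (fun z => w z * (-d ^ 2 * J 1 z) - w₁ z * (d * J 0 z))
      (Ici 0) 0 := by
    have hJ0 := hJc 0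
    have hJ1 := hJc 1
    have : ContinuousOn (fun z => w z * (-d ^ 2 * J 1 z) - w₁ z * (d * J 0 z)) (Ici 0) := by
      fun_prop
    exact this 0 self_mem_Ici
  have key := integral_Ioi_of_hasDerivAt_of_tendsto hcont hderiv (hint1.sub hint2) hlim
  rw [integral_sub hint1 hint2, integral_neg, integral_const_mul, h.w_zero] at key
  simp only [hJ, rayIntegral_at_zero] at key ⊢
  linear_combination -key

/-- Integrates over the half-line, in turn, `w₁'`, `ψ''`, and `(zψ' - ψ)' = zψ''`, where `ψ' = p -
aψ` and `ψ'' = w + a²ψ`. -/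
theorem integral_identities (h : IsDecayingSolution a θ C V V₂ ψ p w w₁)
    (hV : IsScaledProfile b M c δ V V₂) (hb : 0 < b) (hθ : 0 < θ) (hθ1 : θ ≤ 1) (hC : 0 < C)
    (hM : 0 < M) (hδ : 0 < δ) (ha : 0 ≤ a) (ha1 : a ≤ 1) :
    Complex.I * b * (∫ z in Ioi (0 : ℝ), z * w z) =
        -w₁ 0 - ∫ z in Ioi (0 : ℝ), airyDefect a b V V₂ ψ w z ∧
      p 0 - a * ψ 0 = -(∫ z in Ioi (0 : ℝ), w z) - a ^ 2 * ∫ z in Ioi (0 : ℝ), ψ z ∧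
      ψ 0 = (∫ z in Ioi (0 : ℝ), z * w z) + a ^ 2 * ∫ z in Ioi (0 : ℝ), z * ψ z := by
  have hσ : 0 < θ / 2 := half_pos hθ
  obtain ⟨K, hK⟩ := h.exists_w₁_bound hV hb hθ hθ1 hC hM hδ ha ha1
  have hwc := h.system.continuousOn_w
  have hψc := h.system.continuousOn_psi
  have hofc : ContinuousOn (fun z : ℝ => (z : ℂ)) (Ici 0) := by fun_prop
  have hb0 : ∀ f : ℝ → ℂ, (∀ z, 0 ≤ z → ‖f z‖ ≤ C * Real.exp (-(θ * z))) →
      ∀ z, 0 ≤ z → ‖f z‖ ≤ C * (6 / θ) ^ 3 * Real.exp (-(θ / 2 * z)) := fun f hf z hz => by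
    simpa using norm_pow_mul_le hθ hθ1 hC hf (k := 0) (by norm_num) hz
  have hb1 : ∀ f : ℝ → ℂ, (∀ z, 0 ≤ z → ‖f z‖ ≤ C * Real.exp (-(θ * z))) →
      ∀ z : ℝ, 0 ≤ z → ‖z * f z‖ ≤ C * (6 / θ) ^ 3 * Real.exp (-(θ / 2 * z)) := fun f hf z hz => by
    have := norm_pow_mul_le hθ hθ1 hC hf (k := 1) (by norm_num) hz
    rw [norm_mul, Complex.norm_real, Real.norm_of_nonneg hz]
    simpa using this
  have iw := integrableOn_of_exp_decay hσ hwc (hb0 w h.w_bound)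
  have iψ := integrableOn_of_exp_decay hσ hψc (hb0 ψ h.psi_bound)
  have izw : IntegrableOn (fun z : ℝ => z * w z) (Ioi 0) :=
    integrableOn_of_exp_decay hσ (hofc.mul hwc) (hb1 w h.w_bound)
  have izψ : IntegrableOn (fun z : ℝ => z * ψ z) (Ioi 0) :=
    integrableOn_of_exp_decay hσ (hofc.mul hψc) (hb1 ψ h.psi_bound)
  have ig := integrableOn_of_exp_decay hσ (h.continuousOn_airyDefect hV (b := b))
    fun z hz => h.norm_airyDefect_le hV hθ hθ1 hC hM hδ ha ha1 hz
  have tψ := tendsto_zero_of_exp_decay hσ (hb0 ψ h.psi_bound)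
  have tp := tendsto_zero_of_exp_decay hσ (hb0 p h.p_bound)
  have tzψ := tendsto_zero_of_exp_decay hσ (hb1 ψ h.psi_bound)
  have tzp := tendsto_zero_of_exp_decay hσ (hb1 p h.p_bound)
  have hder : ∀ z ∈ Ici (0 : ℝ), HasDerivAt (fun z => p z - a * ψ z) (w z + a ^ 2 * ψ z) z :=
    fun z hz => ((h.system.hasDerivAt_p z hz).sub
      ((h.system.hasDerivAt_psi z hz).const_mul (a : ℂ))).congr_deriv (by ring)
  refine ⟨?_, ?_, ?_⟩
  · have key := integral_Ioi_of_hasDerivAt_of_tendsto'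
      (fun z hz => h.hasDerivAt_w₁' (b := b) hz)
      ((izw.const_mul (Complex.I * b)).add ig) (tendsto_zero_of_exp_decay hσ hK)
    rw [integral_add (izw.const_mul _) ig, integral_const_mul] at key
    linear_combination key
  · have key := integral_Ioi_of_hasDerivAt_of_tendsto' hder (iw.add (iψ.const_mul ((a : ℂ) ^ 2)))
      (by simpa using tp.sub (tψ.const_mul (a : ℂ)))
    rw [integral_add iw (iψ.const_mul _), integral_const_mul] at key
    linear_combination key
  · have key := integral_Ioi_of_hasDerivAt_of_tendsto'
      (f := fun z : ℝ => z * (p z - a * ψ z) - ψ z) (f' := fun z => z * w z + a ^ 2 * (z * ψ z))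
      (fun z hz => (((hasDerivAt_id z).ofReal_comp.mul (hder z hz)).sub
        (h.system.hasDerivAt_psi z hz)).congr_deriv (by simp; ring))
      (izw.add (izψ.const_mul ((a : ℂ) ^ 2)))
      (by
        have := (tzp.sub (tzψ.const_mul (a : ℂ))).sub tψ
        simp only [mul_zero, sub_zero] at this
        refine this.congr fun z => ?_
        ring)
    rw [integral_add izw (izψ.const_mul _), integral_const_mul] at key
    simp only [Complex.ofReal_zero, zero_mul] at key
    linear_combination -key

end IsDecayingSolution

/-! ### The boundary slope and normalisation. -/

theorem exp_I_mul_pi_div_six :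
    Complex.exp (Complex.I * (Real.pi / 6 : ℝ)) = ((Real.sqrt 3 : ℝ) + Complex.I) / 2 := by
  rw [mul_comm, Complex.exp_mul_I, ← Complex.ofReal_cos, ← Complex.ofReal_sin, Real.cos_pi_div_six,
    Real.sin_pi_div_six]
  push_cast
  ring

theorem IsFastSystem.const_mul {a : ℝ} {V V₂ : ℝ → ℝ} {ψ p w w₁ : ℝ → ℂ} {s : Set ℝ}
    (h : IsFastSystem a V V₂ ψ p w w₁ s) (l : ℂ) :
    IsFastSystem a V V₂ (fun z => l * ψ z) (fun z => l * p z) (fun z => l * w z)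
      (fun z => l * w₁ z) s :=
  ⟨fun z hz => ((h.1 z hz).const_mul l).congr_deriv (by ring),
    fun z hz => ((h.2 z hz).const_mul l).congr_deriv (by ring),
    fun z hz => ((h.3 z hz).const_mul l).congr_deriv (by ring),
    fun z hz => ((h.4 z hz).const_mul l).congr_deriv (by ring)⟩

/-- The two Wronskian relations determine `∫ w` and `w₁(0)` up to multiples of `η`; the moment
identities convert them to `ψ'(0)` and `ψ(0)`. The first estimate gives the slope, the second a
lower bound for `|ψ(0)|`. -/
theorem IsDecayingSolution.boundary_values {a b M c δ θ C : ℝ} {V V₂ : ℝ → ℝ} {ψ p w w₁ : ℝ → ℂ}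
    (h : IsDecayingSolution a θ C V V₂ ψ p w w₁)
    (hV : IsScaledProfile b M c δ V V₂) (hb : 0 < b) (hθ : 0 < θ) (hθ1 : θ ≤ 1) (hC : 0 < C)
    (hM : 0 < M) (hδ : 0 < δ) (ha : 0 ≤ a) (ha1 : a ≤ 1) {G₀ G₁ η : ℝ}
    (hG₀ : G₀ = cubicMoment (1 / (3 * b)) 0) (hG₁ : G₁ = cubicMoment (1 / (3 * b)) 1)
    (hη : η = (1 + 2 * M) * (δ + a) * (C * (6 / θ) ^ 3) / (θ / 2)) :
    b * ‖p 0 - a * ψ 0 + Complex.exp (Complex.I * (Real.pi / 6 : ℝ)) * G₀ * ψ 0‖ ≤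
      (4 * G₀ + b + b * G₀) * η ∧ G₁ - (3 + b) * G₀ * η ≤ G₀ * (b * ‖ψ 0‖) := by
  have hσ : 0 < θ / 2 := half_pos hθ
  have hmpos : 0 < 1 / (3 * b) := by positivity
  have hG₀pos : 0 < G₀ := hG₀ ▸ cubicMoment_pos hmpos 0
  have hη0 : 0 ≤ η := by rw [hη]; positivity
  -- `ρ = e^(-iπ/6)`, the cube root of `-i` with positive real part; the other root used is `i`.
  set ρ : ℂ := ((Real.sqrt 3 : ℝ) - Complex.I) / 2 with hρ
  have hs : ((Real.sqrt 3 : ℝ) : ℂ) ^ 2 = 3 := by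
    rw [← Complex.ofReal_pow, Real.sq_sqrt (by norm_num)]
    norm_num
  have hI : Complex.I ^ 2 = -1 := Complex.I_sq
  have hρ3 : ρ ^ 3 = -Complex.I := by
    rw [hρ]
    linear_combination (((Real.sqrt 3 : ℝ) : ℂ) / 8 - 3 / 8 * Complex.I) * hs +
      (3 / 8 * ((Real.sqrt 3 : ℝ) : ℂ) - Complex.I / 8) * hI
  have hρre : 0 ≤ ρ.re := by
    rw [hρ]
    simp
    positivity
  have hρn : ‖ρ‖ = 1 := by
    have h1 : ‖ρ‖ ^ 3 = 1 := by rw [← norm_pow, hρ3, norm_neg, Complex.norm_I]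
    exact (pow_eq_one_iff_of_nonneg (norm_nonneg _) (by norm_num)).1 h1
  have W : ∀ d : ℂ, 0 ≤ d.re → d ^ 3 = -Complex.I → ‖d‖ = 1 → ∃ e : ℂ, ‖e‖ ≤ G₀ * η ∧
      Complex.I * b * ∫ z in Ioi (0 : ℝ), w z = -d ^ 2 * G₁ - d * w₁ 0 * G₀ + e := by
    intro d hd hd3 hdn
    refine ⟨-∫ z in Ioi (0 : ℝ), d * rayIntegral (1 / (3 * b)) d 0 z *
      airyDefect a b V V₂ ψ w z, ?_, ?_⟩
    · rw [norm_neg]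
      refine (norm_integral_le_of_exp_decay hσ (K := G₀ *
        ((1 + 2 * M) * (δ + a) * (C * (6 / θ) ^ 3))) fun z hz => ?_).trans (le_of_eq ?_)
      · rw [norm_mul, norm_mul, hdn, one_mul, mul_assoc G₀]
        refine mul_le_mul ?_ (h.norm_airyDefect_le hV hθ hθ1 hC hM hδ ha ha1 hz)
          (norm_nonneg _) hG₀pos.le
        rw [hG₀]
        exact norm_rayIntegral_le hmpos hd 0 hz
      · rw [hη]; ring
    · rw [h.wronskian_identity hV hb hθ hθ1 hC hM hδ ha ha1 hd hd3, hG₀, hG₁]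
      ring
  obtain ⟨e₁, he₁, h₁⟩ := W Complex.I (by simp) (by rw [pow_succ, hI]; ring) Complex.norm_I
  obtain ⟨e₂, he₂, h₂⟩ := W ρ hρre hρ3 hρn
  obtain ⟨h₃, h₄, h₅⟩ := h.integral_identities hV hb hθ hθ1 hC hM hδ ha ha1
  set X := ∫ z in Ioi (0 : ℝ), w z
  set Y := ∫ z in Ioi (0 : ℝ), z * w z
  set e₃ := ∫ z in Ioi (0 : ℝ), airyDefect a b V V₂ ψ w z with hhe₃
  set e₄ := (a : ℂ) ^ 2 * ∫ z in Ioi (0 : ℝ), ψ z with hhe₄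
  set e₅ := (a : ℂ) ^ 2 * ∫ z in Ioi (0 : ℝ), z * ψ z with hhe₅
  have he₃ : ‖e₃‖ ≤ η := by
    rw [hη]
    exact norm_integral_le_of_exp_decay hσ fun z hz =>
      h.norm_airyDefect_le hV hθ hθ1 hC hM hδ ha ha1 hz
  have hsmall : ∀ x : ℂ, ‖x‖ ≤ C * (6 / θ) ^ 3 / (θ / 2) → ‖(a : ℂ) ^ 2 * x‖ ≤ η := by
    intro x hx
    rw [norm_mul, norm_pow, Complex.norm_real, Real.norm_of_nonneg ha, hη, mul_div_assoc]
    refine mul_le_mul ?_ hx (norm_nonneg _) (by positivity)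
    have e1 : a ^ 2 ≤ a := by nlinarith
    have e2 : 0 ≤ 2 * M * (δ + a) := by positivity
    linarith
  have he₄ : ‖e₄‖ ≤ η := hsmall _ <| norm_integral_le_of_exp_decay hσ fun z hz => by
    simpa using norm_pow_mul_le hθ hθ1 hC h.psi_bound (k := 0) (by norm_num) hz
  have he₅ : ‖e₅‖ ≤ η := hsmall _ <| norm_integral_le_of_exp_decay hσ fun z hz => by
    have := norm_pow_mul_le hθ hθ1 hC h.psi_bound (k := 1) (by norm_num) hz
    rw [norm_mul, Complex.norm_real, Real.norm_of_nonneg hz]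
    simpa using this
  set ρ' : ℂ := Complex.exp (Complex.I * (Real.pi / 6 : ℝ)) with hρ'
  have hρ'' : ρ' = ((Real.sqrt 3 : ℝ) + Complex.I) / 2 := exp_I_mul_pi_div_six
  have hρρ : ρ * ρ' = 1 := by
    rw [hρ, hρ'']
    linear_combination hs / 4 - hI / 4
  have hρ'n : ‖ρ'‖ = 1 := by
    have := congrArg norm hρρ
    rwa [norm_mul, hρn, one_mul, norm_one] at this
  have hsn : (1 : ℝ) ≤ Real.sqrt 3 := Real.one_le_sqrt.2 (by norm_num)
  have hs0 : ((Real.sqrt 3 : ℝ) : ℂ) ≠ 0 := by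
    have : Real.sqrt 3 ≠ 0 := by positivity
    exact_mod_cast this
  have hdiff : ‖(e₂ - e₁) * ρ' / ((Real.sqrt 3 : ℝ) : ℂ)‖ ≤ 2 * (G₀ * η) := by
    rw [norm_div, norm_mul, hρ'n, mul_one, Complex.norm_real,
      Real.norm_of_nonneg (Real.sqrt_nonneg _)]
    refine (div_le_self (norm_nonneg _) hsn).trans ((norm_sub_le _ _).trans ?_)
    linarith
  -- Subtracting the two relations eliminates `∫ w`; `ρ - i = √3 ρ²` and `1 + ρ² = √3 ρ` allow the
  -- common factor `√3 ρ` to be divided out.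
  have hq : G₁ + w₁ 0 * G₀ * ρ = (e₂ - e₁) * ρ' / ((Real.sqrt 3 : ℝ) : ℂ) := by
    rw [eq_div_iff hs0]
    have e := h₂.symm.trans h₁
    have e3 : (ρ - Complex.I) = ((Real.sqrt 3 : ℝ) : ℂ) * ρ ^ 2 := by
      rw [hρ]
      linear_combination (Complex.I / 2 - ((Real.sqrt 3 : ℝ) : ℂ) / 4) * hs -
        ((Real.sqrt 3 : ℝ) : ℂ) / 4 * hI
    have e4 : 1 + ρ ^ 2 = ((Real.sqrt 3 : ℝ) : ℂ) * ρ := by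
      rw [hρ]
      linear_combination -hs / 4 + hI / 4
    have e5 : G₁ * (1 + ρ ^ 2) + w₁ 0 * G₀ * (ρ - Complex.I) = e₂ - e₁ := by
      linear_combination -e + G₁ * hI
    rw [e3, e4] at e5
    linear_combination ρ' * e5 - (G₁ * ((Real.sqrt 3 : ℝ) : ℂ) +
      w₁ 0 * G₀ * ((Real.sqrt 3 : ℝ) : ℂ) * ρ) * hρρ
  have hbn : ‖Complex.I * (b : ℂ)‖ = b := by
    rw [norm_mul, Complex.norm_I, one_mul, Complex.norm_real, Real.norm_of_nonneg hb.le]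
  have hGn : ‖(G₀ : ℂ)‖ = G₀ := by rw [Complex.norm_real, Real.norm_of_nonneg hG₀pos.le]
  constructor
  -- The leading terms cancel because `i - ρ' = -ρ`, with `ρ' = e^(iπ/6)`.
  · have key : Complex.I * b * (p 0 - a * ψ 0 + ρ' * G₀ * ψ 0) =
        -((e₂ - e₁) * ρ' / ((Real.sqrt 3 : ℝ) : ℂ)) - e₁ - Complex.I * b * e₄ - ρ' * G₀ * e₃ +
          Complex.I * b * (ρ' * G₀ * e₅) := by
      have hIρ : Complex.I - ρ' = -ρ := by
        rw [hρ, hρ'']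
        ring
      rw [← hq, h₄]
      linear_combination Complex.I * b * ρ' * G₀ * h₅ + ρ' * G₀ * h₃ - h₁ + G₁ * hI +
        w₁ 0 * G₀ * hIρ
    calc _ = ‖Complex.I * b * (p 0 - a * ψ 0 + ρ' * G₀ * ψ 0)‖ := by rw [norm_mul, hbn]
      _ ≤ 2 * (G₀ * η) + G₀ * η + b * η + G₀ * η + b * (G₀ * η) := by
          rw [key]
          refine (norm_add_le _ _).trans (add_le_add ((norm_sub_le _ _).trans (add_le_add
            ((norm_sub_le _ _).trans (add_le_add ((norm_sub_le _ _).trans (add_le_add ?_ he₁))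
              ?_)) ?_)) ?_)
          · rwa [norm_neg]
          · rw [norm_mul, hbn]; gcongr
          · rw [norm_mul, norm_mul, hρ'n, hGn, one_mul]; gcongr
          · rw [norm_mul, hbn, norm_mul, norm_mul, hρ'n, hGn, one_mul]; gcongr
      _ = _ := by ring
  · have key : (G₁ : ℂ) = (e₂ - e₁) * ρ' / ((Real.sqrt 3 : ℝ) : ℂ) +
        ρ * G₀ * (Complex.I * b * ψ 0) + ρ * G₀ * e₃ - ρ * G₀ * (Complex.I * b * e₅) := by
      rw [← hq, h₅]
      linear_combination (-(ρ * G₀)) * h₃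
    have hn : G₁ = ‖(G₁ : ℂ)‖ := by
      rw [Complex.norm_real, Real.norm_of_nonneg (hG₁ ▸ (cubicMoment_pos hmpos 1).le)]
    have hle : G₁ ≤ 2 * (G₀ * η) + G₀ * (b * ‖ψ 0‖) + G₀ * η + G₀ * (b * η) := by
      rw [hn, key]
      refine (norm_sub_le _ _).trans (add_le_add ((norm_add_le _ _).trans (add_le_add
        ((norm_add_le _ _).trans (add_le_add hdiff ?_)) ?_)) ?_)
      · rw [norm_mul, norm_mul, norm_mul, hbn, hρn, hGn, one_mul]
      · rw [norm_mul, norm_mul, hρn, hGn, one_mul]; gcongr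
      · rw [norm_mul, norm_mul, norm_mul, hbn, hρn, hGn, one_mul]; gcongr
    linarith

theorem exists_normalized_fast_mode {b M c : ℝ} (hb : 0 < b) (hM : 0 < M) (hc : 0 < c) :
    ∃ θ δ₀ C : ℝ, 0 < θ ∧ 0 < δ₀ ∧ δ₀ ≤ 1 ∧ 0 < C ∧
      ∀ (δ a : ℝ) (V V₂ : ℝ → ℝ), 0 < δ → δ ≤ δ₀ → 0 ≤ a → a ≤ δ₀ →
        IsScaledProfile b M c δ V V₂ →
        ∃ ψ p w w₁ : ℝ → ℂ, IsFastSystem a V V₂ ψ p w w₁ (Ici 0) ∧ ψ 0 = 1 ∧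
          (∀ z, 0 ≤ z → ‖w z‖ ≤ C * Real.exp (-(θ * z)) ∧ ‖ψ z‖ ≤ C * Real.exp (-(θ * z)) ∧
            ‖p z‖ ≤ C * Real.exp (-(θ * z))) ∧
          (∃ K, ∀ z, 0 ≤ z → ‖w₁ z‖ ≤ K * Real.exp (-(θ / 2 * z))) ∧
          ‖p 0 - a + Complex.exp (Complex.I * (Real.pi / 6 : ℝ)) *
            cubicMoment (1 / (3 * b)) 0‖ ≤ C * (δ + a) := by
  obtain ⟨θ, δ₁, C, hθ, hθ1, hδ₁, hδ₁1, hC, H⟩ := exists_fast_solution hb hM hc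
  have hmpos : 0 < 1 / (3 * b) := by positivity
  set G₀ := cubicMoment (1 / (3 * b)) 0 with hG₀
  set G₁ := cubicMoment (1 / (3 * b)) 1 with hG₁
  have hG₀pos : 0 < G₀ := cubicMoment_pos hmpos 0
  have hG₁pos : 0 < G₁ := cubicMoment_pos hmpos 1
  set N : ℝ := (1 + 2 * M) * (C * (6 / θ) ^ 3) / (θ / 2) with hN
  have hNpos : 0 < N := by positivity
  -- Half of the limiting value of `|ψ(0)|`; the last entry in the minimum defining `δ₀` keeps the
  -- error below the other half.
  set m₀ : ℝ := G₁ / (2 * (G₀ * b)) with hm₀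
  have hm₀pos : 0 < m₀ := by positivity
  set δ₀ : ℝ := min δ₁ (min (θ / 2) (G₁ / (4 * ((3 + b) * G₀ * N)))) with hδ₀
  have hδ₀1 : δ₀ ≤ δ₁ := min_le_left _ _
  have hδ₀2 : δ₀ ≤ θ / 2 := (min_le_right _ _).trans (min_le_left _ _)
  have hδ₀3 : (3 + b) * G₀ * (N * (2 * δ₀)) ≤ G₁ / 2 := by
    have : δ₀ ≤ G₁ / (4 * ((3 + b) * G₀ * N)) := (min_le_right _ _).trans (min_le_right _ _)
    rw [le_div_iff₀ (by positivity)] at this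
    linarith
  refine ⟨θ, δ₀, C / m₀ + (4 * G₀ + b + b * G₀) * N / (b * m₀), hθ, by positivity,
    hδ₀1.trans hδ₁1, by positivity, ?_⟩
  intro δ a V V₂ hδ hδδ₀ ha haδ₀ hV
  obtain ⟨ψ, p, w, w₁, hsys, hw0, -, hbd⟩ := H δ a V V₂ hδ (hδδ₀.trans hδ₀1) ha
    (haδ₀.trans hδ₀2) hV
  have ha1 : a ≤ 1 := by linarith
  have h : IsDecayingSolution a θ C V V₂ ψ p w w₁ :=
    ⟨hsys, hw0, fun z hz => (hbd z hz).1, fun z hz => (hbd z hz).2.1, fun z hz => (hbd z hz).2.2⟩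
  obtain ⟨k₁, k₂⟩ := h.boundary_values hV hb hθ hθ1 hC hM hδ ha ha1 hG₀ hG₁
    (η := N * (δ + a)) (by rw [hN]; ring)
  have hψ0 : m₀ ≤ ‖ψ 0‖ := by
    have e1 : (3 + b) * G₀ * (N * (δ + a)) ≤ (3 + b) * G₀ * (N * (2 * δ₀)) := by
      gcongr
      linarith
    rw [hm₀, div_le_iff₀ (by positivity)]
    linarith
  have hψpos : 0 < ‖ψ 0‖ := hm₀pos.trans_le hψ0
  have hψne : ψ 0 ≠ 0 := norm_pos_iff.1 hψpos
  have hinv : ‖(ψ 0)⁻¹‖ ≤ 1 / m₀ := by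
    rw [norm_inv, ← one_div]
    exact one_div_le_one_div_of_le hm₀pos hψ0
  obtain ⟨K, hK⟩ := h.exists_w₁_bound hV hb hθ hθ1 hC hM hδ ha ha1
  have hscale : ∀ (f : ℝ → ℂ), (∀ z, 0 ≤ z → ‖f z‖ ≤ C * Real.exp (-(θ * z))) → ∀ z, 0 ≤ z →
      ‖(ψ 0)⁻¹ * f z‖ ≤ (C / m₀ + (4 * G₀ + b + b * G₀) * N / (b * m₀)) *
        Real.exp (-(θ * z)) := by
    intro f hf z hz
    rw [norm_mul]
    calc _ ≤ 1 / m₀ * (C * Real.exp (-(θ * z))) := by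
          gcongr
          exact hf z hz
      _ = C / m₀ * Real.exp (-(θ * z)) := by ring
      _ ≤ _ := by
        gcongr
        have : 0 ≤ (4 * G₀ + b + b * G₀) * N / (b * m₀) := by positivity
        linarith
  refine ⟨_, _, _, _, hsys.const_mul (ψ 0)⁻¹, inv_mul_cancel₀ hψne, fun z hz =>
    ⟨hscale w h.w_bound z hz, hscale ψ h.psi_bound z hz, hscale p h.p_bound z hz⟩,
    ⟨‖(ψ 0)⁻¹‖ * K, fun z hz => ?_⟩, ?_⟩
  · rw [norm_mul, mul_assoc]
    exact mul_le_mul_of_nonneg_left (hK z hz) (norm_nonneg _)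
  · have e1 : (ψ 0)⁻¹ * p 0 - a + Complex.exp (Complex.I * (Real.pi / 6 : ℝ)) * G₀ =
        (ψ 0)⁻¹ * (p 0 - a * ψ 0 +
          Complex.exp (Complex.I * (Real.pi / 6 : ℝ)) * G₀ * ψ 0) := by
      field_simp
    rw [e1, norm_mul]
    have k₃ := (le_div_iff₀' hb).2 k₁
    calc _ ≤ 1 / m₀ * ((4 * G₀ + b + b * G₀) * (N * (δ + a)) / b) := by gcongr
      _ = (4 * G₀ + b + b * G₀) * N / (b * m₀) * (δ + a) := by field_simp
      _ ≤ _ := by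
        gcongr
        have : 0 ≤ C / m₀ := by positivity
        linarith

/-! ### Estimates for the shear profile and its rescaling. -/

namespace IsPrandtlProfile

variable {Us : ℝ → ℝ} {UE : ℝ}

theorem hasDerivWithinAt (h : IsPrandtlProfile Us UE) {Y : ℝ} (hY : 0 ≤ Y) :
    HasDerivWithinAt Us (derivWithin Us (Ici 0) Y) (Ici 0) Y :=
  ((h.contDiffOn.differentiableOn (by norm_num)) Y hY).hasDerivWithinAt

theorem hasDerivWithinAt_derivWithin (h : IsPrandtlProfile Us UE) {Y : ℝ} (hY : 0 ≤ Y) :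
    HasDerivWithinAt (derivWithin Us (Ici 0)) (iteratedDerivWithin 2 Us (Ici 0) Y) (Ici 0) Y := by
  have h1 := h.contDiffOn.differentiableOn_iteratedDerivWithin (m := 1) (by norm_num)
    (uniqueDiffOn_Ici 0)
  have h2 := (h1 Y hY).hasDerivWithinAt
  rw [← iteratedDerivWithin_succ] at h2
  rwa [iteratedDerivWithin_one] at h2

theorem exists_second_deriv_bound (h : IsPrandtlProfile Us UE) :
    ∃ M, 0 < M ∧ ∀ Y, 0 ≤ Y → |iteratedDerivWithin 2 Us (Ici 0) Y| ≤ M := by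
  obtain ⟨M, hM⟩ := h.decay 2 (by simp)
  refine ⟨|M| + 1, by positivity, fun Y hY => ?_⟩
  have h1 : 1 ≤ (1 + Y) ^ 3 := one_le_pow₀ (by linarith)
  have h2 := le_mul_of_one_le_left (abs_nonneg (iteratedDerivWithin 2 Us (Ici 0) Y)) h1
  linarith [hM Y hY, le_abs_self M]

theorem abs_sub_linear_le (h : IsPrandtlProfile Us UE) {M : ℝ}
    (hM : ∀ Y, 0 ≤ Y → |iteratedDerivWithin 2 Us (Ici 0) Y| ≤ M) {Y : ℝ} (hY : 0 ≤ Y) :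
    |Us Y - derivWithin Us (Ici 0) 0 * Y| ≤ M * Y ^ 2 := by
  have hM0 : 0 ≤ M := (abs_nonneg _).trans (hM 0 le_rfl)
  have h1 : ∀ y ∈ Icc 0 Y, ‖derivWithin Us (Ici 0) y - derivWithin Us (Ici 0) 0‖ ≤ M * Y := by
    intro y hy
    refine ((convex_Icc 0 Y).norm_image_sub_le_of_norm_hasDerivWithin_le
      (fun x hx => (h.hasDerivWithinAt_derivWithin hx.1).mono Icc_subset_Ici_self)
      (fun x hx => hM x hx.1) ⟨le_rfl, hY⟩ hy).trans ?_
    rw [sub_zero, Real.norm_of_nonneg hy.1]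
    gcongr
    exact hy.2
  have hlin : ∀ y ∈ Icc 0 Y, HasDerivWithinAt (fun y => Us y - derivWithin Us (Ici 0) 0 * y)
      (derivWithin Us (Ici 0) y - derivWithin Us (Ici 0) 0) (Icc 0 Y) y := by
    intro y hy
    have h2 := (h.hasDerivWithinAt hy.1).mono (Icc_subset_Ici_self (a := Y))
    generalize derivWithin Us (Ici 0) 0 = l
    have h3 : HasDerivWithinAt (fun y : ℝ => l * y) l (Icc 0 Y) y := by
      simpa using (hasDerivWithinAt_id y (Icc 0 Y)).const_mul l
    exact h2.fun_sub h3
  have h2 := (convex_Icc 0 Y).norm_image_sub_le_of_norm_hasDerivWithin_le hlin h1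
    ⟨le_rfl, hY⟩ ⟨hY, le_rfl⟩
  rw [h.map_zero, mul_zero, sub_zero, sub_zero, sub_zero, Real.norm_eq_abs, Real.norm_eq_abs,
    abs_of_nonneg hY] at h2
  exact h2.trans (le_of_eq (by ring))

/-- Three ranges: up to `r = b/(2M)` the linear part dominates and the slope is at least `b/2`; far
out `Us ≥ UE/2`; in between, positivity and compactness. -/
theorem exists_lower_bound (h : IsPrandtlProfile Us UE) :
    ∃ c, 0 < c ∧ ∀ Y, 0 ≤ Y → c * (Y / (1 + Y)) ≤ Us Y := by
  obtain ⟨M, hM0, hM⟩ := h.exists_second_deriv_bound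
  set b := derivWithin Us (Ici 0) 0 with hb
  have hbpos : 0 < b := h.deriv_zero_pos
  set r := b / (2 * M) with hr
  have hrpos : 0 < r := by positivity
  obtain ⟨R, hR⟩ := eventually_atTop.1
    (h.tendsto_atTop.eventually_const_le (half_lt_self h.limit_pos))
  have hcont : ContinuousOn Us (Icc r (max r R)) :=
    h.contDiffOn.continuousOn.mono fun y hy => hrpos.le.trans hy.1
  obtain ⟨y₀, hy₀, hmin⟩ := isCompact_Icc.exists_isMinOn ⟨r, le_rfl, le_max_left _ _⟩ hcont
  have hm : 0 < Us y₀ := h.pos y₀ (hrpos.trans_le hy₀.1)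
  have hUE := h.limit_pos
  refine ⟨min (b / 2) (min (UE / 2) (Us y₀)), by positivity, fun Y hY => ?_⟩
  have hq0 : 0 ≤ Y / (1 + Y) := by positivity
  have hq1 : Y / (1 + Y) ≤ 1 := by rw [div_le_one (by positivity)]; linarith
  have hqY : Y / (1 + Y) ≤ Y := div_le_self hY (by linarith)
  have hlarge : ∀ x, 0 < x → min (b / 2) (min (UE / 2) (Us y₀)) ≤ x → x ≤ Us Y →
      min (b / 2) (min (UE / 2) (Us y₀)) * (Y / (1 + Y)) ≤ Us Y := fun x hx h1 h2 =>
    calc _ ≤ x * 1 := mul_le_mul h1 hq1 hq0 hx.le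
      _ ≤ Us Y := by rwa [mul_one]
  rcases le_or_gt Y r with h1 | h1
  · have h2 := (abs_le.1 (h.abs_sub_linear_le hM hY)).1
    have h3 : M * Y ^ 2 ≤ b / 2 * Y := by
      calc M * Y ^ 2 = M * Y * Y := by ring
        _ ≤ M * r * Y := by gcongr
        _ = b / 2 * Y := by rw [hr]; field_simp
    calc _ ≤ b / 2 * Y := mul_le_mul (min_le_left _ _) hqY hq0 (by positivity)
      _ ≤ Us Y := by linarith
  · rcases le_or_gt R Y with h2 | h2
    · exact hlarge _ (half_pos hUE) ((min_le_right _ _).trans (min_le_left _ _)) (hR Y h2)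
    · exact hlarge _ hm ((min_le_right _ _).trans (min_le_right _ _))
        (hmin ⟨h1.le, h2.le.trans (le_max_right _ _)⟩)

theorem exists_bound (h : IsPrandtlProfile Us UE) : ∃ K, ∀ Y, 0 ≤ Y → |Us Y| ≤ K := by
  obtain ⟨R, hR⟩ := eventually_atTop.1
    (h.tendsto_atTop.abs.eventually_le_const (lt_add_one |UE|))
  obtain ⟨K, hK⟩ := isCompact_Icc.exists_bound_of_continuousOn
    (h.contDiffOn.continuousOn.mono (Icc_subset_Ici_self (a := R)))
  refine ⟨max K (|UE| + 1), fun Y hY => ?_⟩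
  rcases le_total R Y with h1 | h1
  · exact (hR Y h1).trans (le_max_right _ _)
  · exact (hK Y ⟨hY, h1⟩).trans (le_max_left _ _)

/-- Rescaling a Prandtl profile by the sublayer thickness `δ`. -/
theorem isScaledProfile (h : IsPrandtlProfile Us UE) {c M δ : ℝ} (hc : 0 < c)
    (hlow : ∀ Y, 0 ≤ Y → c * (Y / (1 + Y)) ≤ Us Y)
    (hM : ∀ Y, 0 ≤ Y → |iteratedDerivWithin 2 Us (Ici 0) Y| ≤ M) (hδ : 0 < δ) (hδ1 : δ ≤ 1) :
    IsScaledProfile (derivWithin Us (Ici 0) 0) M c δ (fun z => Us (δ * max z 0) / δ)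
      (fun z => δ * iteratedDerivWithin 2 Us (Ici 0) (δ * max z 0)) := by
  -- `max z 0` freezes the coefficients for `z < 0`, so that they are continuous and bounded on all
  -- of `ℝ`.
  have hmem : ∀ z : ℝ, δ * max z 0 ∈ Ici (0 : ℝ) := fun z => by
    have := le_max_right z 0
    exact mul_nonneg hδ.le this
  have hmc : Continuous fun z : ℝ => δ * max z 0 := by fun_prop
  refine ⟨?_, ?_, fun z hz => ?_, fun z hz => ?_, fun z hz => ?_, ?_⟩
  · exact (h.contDiffOn.continuousOn.comp_continuous hmc hmem).div_const δ
  · exact ((h.contDiffOn.continuousOn_iteratedDerivWithin (by norm_num)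
      (uniqueDiffOn_Ici 0)).comp_continuous hmc hmem).const_mul δ
  · simp only [max_eq_left hz]
    rw [le_div_iff₀ hδ]
    refine le_trans ?_ (hlow (δ * z) (by positivity))
    rw [mul_assoc]
    refine mul_le_mul_of_nonneg_left ?_ hc.le
    -- `δz/(1+z) ≤ δz/(1+δz)` since `δ ≤ 1`: the constant `c` survives the rescaling.
    rw [div_mul_eq_mul_div, mul_comm z δ]
    gcongr
    exact mul_le_of_le_one_left hz hδ1
  · simp only [max_eq_left hz]
    have h1 := h.abs_sub_linear_le hM (Y := δ * z) (by positivity)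
    have h2 : Us (δ * z) / δ - derivWithin Us (Ici 0) 0 * z =
        (Us (δ * z) - derivWithin Us (Ici 0) 0 * (δ * z)) / δ := by field_simp
    rw [h2, abs_div, abs_of_pos hδ, div_le_iff₀ hδ]
    exact h1.trans (le_of_eq (by ring))
  · simp only [max_eq_left hz]
    rw [abs_mul, abs_of_pos hδ, mul_comm]
    exact mul_le_mul_of_nonneg_right (hM _ (by positivity)) hδ.le
  · obtain ⟨K, hK⟩ := h.exists_bound
    refine ⟨max (K / δ) (δ * M), fun z => ⟨?_, ?_⟩⟩
    · rw [abs_div, abs_of_pos hδ]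
      exact le_max_of_le_left (div_le_div_of_nonneg_right (hK _ (hmem z)) hδ.le)
    · rw [abs_mul, abs_of_pos hδ]
      exact le_max_of_le_right (mul_le_mul_of_nonneg_left (hM _ (hmem z)) hδ.le)

/-- The cubic moment is `(3b)^(1/3) Γ(1/3)/3`, and `3^(1/3)/3 = 3^(-2/3)`. -/
theorem fastModeCoeff_eq (h : IsPrandtlProfile Us UE) :
    fastModeCoeff Us = Complex.exp (Complex.I * (Real.pi / 6 : ℝ)) *
      cubicMoment (1 / (3 * derivWithin Us (Ici 0) 0)) 0 := by
  have hb := h.deriv_zero_pos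
  rw [fastModeCoeff, cubicMoment_zero (by positivity)]
  congr 2
  rw [one_div (3 * _), Real.inv_rpow (by positivity), ← Real.rpow_neg (by positivity), neg_neg,
    Real.mul_rpow (by norm_num) hb.le]
  have h3 : (3 : ℝ) ^ (-(2 / 3) : ℝ) = 3 ^ (1 / 3 : ℝ) * (1 / 3) := by
    rw [show (-(2 / 3) : ℝ) = 1 / 3 - 1 by norm_num, Real.rpow_sub_one (by norm_num)]
    ring
  rw [h3]
  ring

end IsPrandtlProfile

/-! ### `L²` norms, weak derivatives and membership in `H⁴`. -/

theorem integral_norm_sq_le_of_exp_decay {f : ℝ → ℂ} {K σ : ℝ} (hσ : 0 < σ)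
    (hf : ContinuousOn f (Ici 0)) (hb : ∀ z, 0 ≤ z → ‖f z‖ ≤ K * Real.exp (-(σ * z))) :
    IntegrableOn (fun z => ‖f z‖ ^ 2) (Ioi 0) ∧
      ∫ z in Ioi (0 : ℝ), ‖f z‖ ^ 2 ≤ K ^ 2 / (2 * σ) := by
  have hb2 : ∀ z, 0 ≤ z → ‖((‖f z‖ ^ 2 : ℝ) : ℂ)‖ ≤ K ^ 2 * Real.exp (-(2 * σ * z)) := by
    intro z hz
    rw [Complex.norm_real, norm_pow, norm_norm]
    calc ‖f z‖ ^ 2 ≤ (K * Real.exp (-(σ * z))) ^ 2 := by gcongr; exact hb z hz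
      _ = _ := by
        rw [mul_pow, ← Real.exp_nat_mul]
        congr 2
        push_cast
        ring
  have h2σ : 0 < 2 * σ := by positivity
  have h1 := (integrableOn_of_exp_decay h2σ (by fun_prop) hb2).re
  have h2 := norm_integral_le_of_exp_decay h2σ hb2
  rw [integral_complex_ofReal, Complex.norm_real] at h2
  exact ⟨h1, (le_abs_self _).trans h2⟩

theorem memLp_two_of_exp_decay {f : ℝ → ℂ} {K σ : ℝ} (hσ : 0 < σ)
    (hf : ContinuousOn f (Ici 0)) (hb : ∀ z, 0 ≤ z → ‖f z‖ ≤ K * Real.exp (-(σ * z))) :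
    MemLp f 2 halfLine :=
  (memLp_two_iff_integrable_sq_norm
    ((hf.mono Ioi_subset_Ici_self).aestronglyMeasurable measurableSet_Ioi)).2
    (integral_norm_sq_le_of_exp_decay hσ hf hb).1

theorem normL2_le_of_exp_decay {f : ℝ → ℂ} {K σ : ℝ} (hσ : 0 < σ) (hK : 0 ≤ K)
    (hf : ContinuousOn f (Ici 0)) (hb : ∀ z, 0 ≤ z → ‖f z‖ ≤ K * Real.exp (-(σ * z))) :
    normL2 f ≤ K / Real.sqrt (2 * σ) := by
  rw [normL2]
  refine (Real.sqrt_le_sqrt (integral_norm_sq_le_of_exp_decay hσ hf hb).2).trans (le_of_eq ?_)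
  rw [Real.sqrt_div (sq_nonneg K), Real.sqrt_sq hK]

/-- Integration by parts; the test function vanishes near 0, so `g` need not be controlled there. -/
theorem hasWeakDeriv_of_hasDerivAt {g g' : ℝ → ℂ} (hg : ∀ z, 0 < z → HasDerivAt g (g' z) z)
    (hg' : ContinuousOn g' (Ioi 0)) : HasWeakDeriv g g' := by
  have hgc : ContinuousOn g (Ioi 0) := fun z hz => (hg z hz).continuousAt.continuousWithinAt
  refine ⟨hgc.locallyIntegrableOn measurableSet_Ioi, hg'.locallyIntegrableOn measurableSet_Ioi,
    fun η hη hcomp hsupp => ?_⟩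
  have hηc : Continuous η := hη.continuous
  have hηc' : Continuous (deriv η) := hη.continuous_deriv (by norm_num)
  have hint : ∀ (κ : ℝ → ℝ) (f : ℝ → ℂ), Continuous κ → (∀ z, z ∉ tsupport η → κ z = 0) →
      ContinuousOn f (Ioi 0) → IntegrableOn (fun z => κ z • f z) (Ioi 0) := by
    intro κ f hκ hκ0 hf
    have h1 : IntegrableOn (fun z => κ z • f z) (tsupport η) :=
      (hκ.continuousOn.smul (hf.mono hsupp)).integrableOn_compact hcomp
    exact h1.of_forall_sdiff_eq_zero measurableSet_Ioi fun z hz => by rw [hκ0 z hz.2, zero_smul]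
  have hη0 : ∀ z, z ∉ tsupport η → η z = 0 := fun z hz => image_eq_zero_of_notMem_tsupport hz
  have hη0' : ∀ z, z ∉ tsupport η → deriv η z = 0 := fun z hz => by
    by_contra h0
    exact hz (support_deriv_subset (Function.mem_support.2 h0))
  have i1 := hint (deriv η) g hηc' hη0' hgc
  have i2 := hint η g' hηc hη0 hg'
  have h0 : (0 : ℝ) ∉ tsupport η := fun h => lt_irrefl (0 : ℝ) (hsupp h)
  have hnear : (fun z => η z • g z) =ᶠ[𝓝 0] fun _ => 0 := by
    filter_upwards [(isClosed_tsupport η).isOpen_compl.mem_nhds h0] with z hz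
    rw [hη0 z hz, zero_smul]
  have hlim : Tendsto (fun z => η z • g z) atTop (𝓝 0) := by
    obtain ⟨R, hR⟩ := hcomp.isBounded.subset_closedBall 0
    refine tendsto_const_nhds.congr' ?_
    filter_upwards [eventually_gt_atTop R] with z hz
    rw [hη0 z, zero_smul]
    intro h
    have h1 : |z| ≤ R := by simpa using hR h
    exact absurd ((le_abs_self z).trans h1) (not_le.2 hz)
  have key := integral_Ioi_of_hasDerivAt_of_tendsto (f := fun z => η z • g z)
    (f' := fun z => deriv η z • g z + η z • g' z)
    (continuousAt_const.congr hnear.symm).continuousWithinAt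
    (fun z hz => ((((hη.differentiable (by norm_num)) z).hasDerivAt).smul (hg z hz)).congr_deriv
      (add_comm _ _)) (i1.add i2) hlim
  rw [integral_add i1 i2, hη0 0 h0, zero_smul, sub_zero] at key
  exact eq_neg_of_add_eq_zero_left key

/-- A chain of classical derivatives with exponential decay defines an element of `H^k(ℝ₊)`. -/
def SobolevH.ofExpDecay (k : ℕ) (f : ℕ → ℝ → ℂ) {σ : ℝ} (hσ : 0 < σ)
    (hf : ∀ j < k, ∀ z, 0 ≤ z → HasDerivAt (f j) (f (j + 1) z) z)
    (hc : ∀ j ≤ k, ContinuousOn (f j) (Ici 0))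
    (hb : ∀ j ≤ k, ∃ K, ∀ z, 0 ≤ z → ‖f j z‖ ≤ K * Real.exp (-(σ * z))) : SobolevH k where
  d := f
  memLp j hj := memLp_two_of_exp_decay hσ (hc j hj) (hb j hj).choose_spec
  weakDeriv j hj := hasWeakDeriv_of_hasDerivAt (fun z hz => hf j hj z hz.le)
    ((hc (j + 1) hj).mono Ioi_subset_Ici_self)

theorem exp_decay_combination {f g : ℝ → ℂ} {σ : ℝ} (x y : ℂ)
    (hf : ∃ K, ∀ z, 0 ≤ z → ‖f z‖ ≤ K * Real.exp (-(σ * z)))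
    (hg : ∃ K, ∀ z, 0 ≤ z → ‖g z‖ ≤ K * Real.exp (-(σ * z))) :
    ∃ K, ∀ z, 0 ≤ z → ‖x * f z + y * g z‖ ≤ K * Real.exp (-(σ * z)) := by
  obtain ⟨K, hK⟩ := hf
  obtain ⟨L, hL⟩ := hg
  refine ⟨‖x‖ * K + ‖y‖ * L, fun z hz => (norm_add_le _ _).trans ?_⟩
  rw [norm_mul, norm_mul, add_mul, mul_assoc, mul_assoc]
  exact add_le_add (mul_le_mul_of_nonneg_left (hK z hz) (norm_nonneg _))
    (mul_le_mul_of_nonneg_left (hL z hz) (norm_nonneg _))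

theorem exp_decay_mul_bounded {f g : ℝ → ℂ} {σ : ℝ} (hg : ∃ L, ∀ z, ‖g z‖ ≤ L)
    (hf : ∃ K, ∀ z, 0 ≤ z → ‖f z‖ ≤ K * Real.exp (-(σ * z))) :
    ∃ K, ∀ z, 0 ≤ z → ‖g z * f z‖ ≤ K * Real.exp (-(σ * z)) := by
  obtain ⟨L, hL⟩ := hg
  obtain ⟨K, hK⟩ := hf
  refine ⟨L * K, fun z hz => ?_⟩
  rw [norm_mul, mul_assoc]
  exact mul_le_mul (hL z) (hK z hz) (norm_nonneg _) ((norm_nonneg _).trans (hL z))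

/-- The successive derivatives of the stream function of a solution of the first order system. -/
noncomputable def streamDeriv (a : ℝ) (V V₂ : ℝ → ℝ) (ψ p w w₁ : ℝ → ℂ) : ℕ → ℝ → ℂ
  | 0, z => ψ z
  | 1, z => p z - a * ψ z
  | 2, z => a ^ 2 * ψ z + w z
  | 3, z => a ^ 2 * (p z - a * ψ z) + w₁ z
  | 4, z => a ^ 2 * (a ^ 2 * ψ z + w z) +
      (a ^ 2 * w z + Complex.I * V z * w z - Complex.I * V₂ z * ψ z)
  | _, _ => 0

namespace IsFastSystem

variable {a σ : ℝ} {V V₂ : ℝ → ℝ} {ψ p w w₁ : ℝ → ℂ}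

theorem hasDerivAt_streamDeriv (h : IsFastSystem a V V₂ ψ p w w₁ (Ici 0)) {j : ℕ} (hj : j < 4)
    {z : ℝ} (hz : 0 ≤ z) :
    HasDerivAt (streamDeriv a V V₂ ψ p w w₁ j) (streamDeriv a V V₂ ψ p w w₁ (j + 1) z) z := by
  have h0 := h.hasDerivAt_psi z hz
  have h1 : HasDerivAt (fun z => p z - a * ψ z) (a ^ 2 * ψ z + w z) z :=
    ((h.hasDerivAt_p z hz).sub (h0.const_mul (a : ℂ))).congr_deriv (by ring)
  have hw := h.hasDerivAt_w z hz
  have hw₁ := h.hasDerivAt_w₁ z hz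
  interval_cases j
  · exact h0
  · exact h1
  · exact (h0.const_mul ((a : ℂ) ^ 2)).add hw
  · exact (h1.const_mul ((a : ℂ) ^ 2)).add hw₁

theorem continuousOn_streamDeriv (h : IsFastSystem a V V₂ ψ p w w₁ (Ici 0)) (hV : Continuous V)
    (hV₂ : Continuous V₂) {j : ℕ} (hj : j ≤ 4) :
    ContinuousOn (streamDeriv a V V₂ ψ p w w₁ j) (Ici 0) := by
  rcases hj.lt_or_eq with hj | rfl
  · exact fun z hz => (h.hasDerivAt_streamDeriv hj hz).continuousAt.continuousWithinAt
  · have h1 := h.continuousOn_psi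
    have h2 := h.continuousOn_w
    have h3 : ContinuousOn (fun z => ((V z : ℝ) : ℂ)) (Ici 0) := by fun_prop
    have h4 : ContinuousOn (fun z => ((V₂ z : ℝ) : ℂ)) (Ici 0) := by fun_prop
    have : ContinuousOn (fun z => (a : ℂ) ^ 2 * (a ^ 2 * ψ z + w z) +
      (a ^ 2 * w z + Complex.I * V z * w z - Complex.I * V₂ z * ψ z)) (Ici 0) := by fun_prop
    exact this

theorem exists_streamDeriv_bound (hbdd : ∃ K, ∀ z, |V z| ≤ K ∧ |V₂ z| ≤ K)
    (hψ : ∃ K, ∀ z, 0 ≤ z → ‖ψ z‖ ≤ K * Real.exp (-(σ * z)))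
    (hp : ∃ K, ∀ z, 0 ≤ z → ‖p z‖ ≤ K * Real.exp (-(σ * z)))
    (hw : ∃ K, ∀ z, 0 ≤ z → ‖w z‖ ≤ K * Real.exp (-(σ * z)))
    (hw₁ : ∃ K, ∀ z, 0 ≤ z → ‖w₁ z‖ ≤ K * Real.exp (-(σ * z))) {j : ℕ} (hj : j ≤ 4) :
    ∃ K, ∀ z, 0 ≤ z → ‖streamDeriv a V V₂ ψ p w w₁ j z‖ ≤ K * Real.exp (-(σ * z)) := by
  obtain ⟨K, hK⟩ := hbdd
  have h1 := exp_decay_combination 1 (-a) hp hψ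
  have h2 := exp_decay_combination (a ^ 2) 1 hψ hw
  have h3 := exp_decay_combination (a ^ 2) 1 h1 hw₁
  have hVw := exp_decay_mul_bounded (g := fun z => ((V z : ℝ) : ℂ))
    ⟨K, fun z => by simpa using (hK z).1⟩ hw
  have hVψ := exp_decay_mul_bounded (g := fun z => ((V₂ z : ℝ) : ℂ))
    ⟨K, fun z => by simpa using (hK z).2⟩ hψ
  have h4 := exp_decay_combination 1 1 (exp_decay_combination (a ^ 2) (a ^ 2) h2 hw)
    (exp_decay_combination Complex.I (-Complex.I) hVw hVψ)
  have htr : ∀ {f g : ℝ → ℂ}, (∃ K, ∀ z, 0 ≤ z → ‖f z‖ ≤ K * Real.exp (-(σ * z))) →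
      (∀ z, g z = f z) → ∃ K, ∀ z, 0 ≤ z → ‖g z‖ ≤ K * Real.exp (-(σ * z)) :=
    fun hf hfg => by simpa only [hfg] using hf
  interval_cases j
  · exact hψ
  · exact htr h1 fun z => by simp only [streamDeriv]; ring
  · exact htr h2 fun z => by simp only [streamDeriv]; ring
  · exact htr h3 fun z => by simp only [streamDeriv]; ring
  · exact htr h4 fun z => by simp only [streamDeriv]; ring

end IsFastSystem

/-! ### Return to the original variables. -/

/-- Splits `q` in proportion to `y` and `x`; this turns the remainder `O(δ + a)` into the separate
`r` and `s`. -/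
theorem exists_split_of_norm_le {q : ℂ} {C x y : ℝ} (hx : 0 < x) (hy : 0 ≤ y)
    (hq : ‖q‖ ≤ C * (x + y)) : ∃ r s : ℂ, q = r + s ∧ ‖r‖ ≤ C * y ∧ ‖s‖ ≤ C * x := by
  have hxy : 0 < x + y := by positivity
  have hxy' : ((x + y : ℝ) : ℂ) ≠ 0 := by exact_mod_cast hxy.ne'
  have hpart : ∀ t : ℝ, 0 ≤ t → ‖q * ((t / (x + y) : ℝ) : ℂ)‖ ≤ C * t := by
    intro t ht
    rw [norm_mul, Complex.norm_real, Real.norm_of_nonneg (by positivity), ← mul_div_assoc,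
      div_le_iff₀ hxy]
    calc ‖q‖ * t ≤ C * (x + y) * t := by gcongr
      _ = _ := by ring
  refine ⟨_, _, ?_, hpart y hy, hpart x hx.le⟩
  push_cast at hxy' ⊢
  field_simp
  ring

theorem proposition6 (Us : ℝ → ℝ) (UE : ℝ) (hUs : IsPrandtlProfile Us UE) :
    ∃ ε₁ : ℝ, 0 < ε₁ ∧ ∃ δ₁ : ℝ, 0 < δ₁ ∧ ∃ C : ℝ, 0 < C ∧
      ∀ ε α : ℝ, 0 < ε → ε ≤ ε₁ → 0 < α → ε ^ (1 / 3 : ℝ) * α ≤ δ₁ →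
        ∃ φ : SobolevH 4,
          (∀ᵐ Y ∂halfLine, orrSommerfeld Us ε α φ Y = 0) ∧
          normL2 (φ.d 1) + α * normL2 (φ.d 0) ≤ C / ε ^ (1 / 6 : ℝ) ∧
          normL2 (helmholtz α φ) ≤ C / ε ^ (1 / 2 : ℝ) ∧
          HasBoundaryValue (φ.d 0) 1 ∧
          ∃ r s : ℂ, ‖r‖ ≤ C * (ε ^ (1 / 3 : ℝ) * α) ∧ ‖s‖ ≤ C * ε ^ (1 / 3 : ℝ) ∧
            HasBoundaryValue (φ.d 1)
              ((-fastModeCoeff Us + r + s) * ((ε ^ (-(1 / 3) : ℝ) : ℝ) : ℂ)) := by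
  obtain ⟨c, hc, hlow⟩ := hUs.exists_lower_bound
  obtain ⟨M, hM0, hM⟩ := hUs.exists_second_deriv_bound
  obtain ⟨θ, δ₀, C, hθ, hδ₀, hδ₀1, hC, H⟩ :=
    exists_normalized_fast_mode hUs.deriv_zero_pos hM0 hc
  have hsθ : 0 < Real.sqrt (2 * θ) := by positivity
  -- `ε₁ = δ₀³` because `δ = ε^(1/3)`. The factor 3 counts `p` and `aψ` in `∂_Y φ`, plus `αφ`.
  refine ⟨δ₀ ^ 3, by positivity, δ₀, hδ₀, C + 3 * C / Real.sqrt (2 * θ), by positivity, ?_⟩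
  intro ε α hε hεε₁ hα hεα
  -- With `t = ε^(1/6)` every power of `ε` that occurs is an integer power of `t`; in particular `δ
  -- = t²`.
  obtain ⟨t, ht, rfl⟩ : ∃ t : ℝ, 0 < t ∧ t ^ 6 = ε := ⟨ε ^ (1 / 6 : ℝ), by positivity, by
    rw [← Real.rpow_natCast, ← Real.rpow_mul hε.le]
    norm_num⟩
  have e6 : (t ^ 6) ^ (1 / 6 : ℝ) = t := by
    rw [← Real.rpow_natCast, ← Real.rpow_mul ht.le]; norm_num
  have e3 : (t ^ 6) ^ (1 / 3 : ℝ) = t ^ 2 := by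
    rw [← Real.rpow_natCast, ← Real.rpow_mul ht.le, ← Real.rpow_natCast]; norm_num
  have e2 : (t ^ 6) ^ (1 / 2 : ℝ) = t ^ 3 := by
    rw [← Real.rpow_natCast, ← Real.rpow_mul ht.le, ← Real.rpow_natCast]; norm_num
  have e3' : (t ^ 6) ^ (-(1 / 3) : ℝ) = (t ^ 2)⁻¹ := by rw [Real.rpow_neg (by positivity), e3]
  rw [e3] at hεα ⊢
  rw [e6, e2, e3']
  set δ : ℝ := t ^ 2 with hδ
  have hδpos : 0 < δ := by positivity
  have hδδ₀ : δ ≤ δ₀ := by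
    refine le_of_pow_le_pow_left₀ (n := 3) (by norm_num) hδ₀.le ?_
    rw [hδ, ← pow_mul]
    exact hεε₁
  set a : ℝ := δ * α with ha
  have hapos : 0 < a := by positivity
  have ha1 : a ≤ 1 := hεα.trans hδ₀1
  set V : ℝ → ℝ := fun z => Us (δ * max z 0) / δ with hV
  set V₂ : ℝ → ℝ := fun z => δ * iteratedDerivWithin 2 Us (Ici 0) (δ * max z 0) with hV₂
  have hprof : IsScaledProfile (derivWithin Us (Ici 0) 0) M c δ V V₂ :=
    hUs.isScaledProfile hc hlow hM hδpos (hδδ₀.trans hδ₀1)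
  obtain ⟨ψ, p, w, w₁, hsys, hψ0, hbd, hw₁, hcoef⟩ := H δ a V V₂ hδpos hδδ₀ hapos.le hεα hprof
  rw [← hUs.fastModeCoeff_eq] at hcoef
  set F := streamDeriv a V V₂ ψ p w w₁ with hF
  have hδc : (δ : ℂ) ≠ 0 := by exact_mod_cast hδpos.ne'
  let f : ℕ → ℝ → ℂ := fun j Y => ((δ : ℂ)⁻¹) ^ j * F j (Y / δ)
  have hdivpos : ∀ Y : ℝ, 0 ≤ Y → 0 ≤ Y / δ := fun Y hY => by positivity
  have hexp : ∀ (κ Y : ℝ), Real.exp (-(κ * (Y / δ))) = Real.exp (-(κ / δ * Y)) := fun κ Y => by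
    congr 1
    ring
  have hfderiv : ∀ j < 4, ∀ Y, 0 ≤ Y → HasDerivAt (f j) (f (j + 1) Y) Y := by
    intro j hj Y hY
    have h1 := hsys.hasDerivAt_streamDeriv hj (hdivpos Y hY)
    have h2 := (h1.scomp Y ((hasDerivAt_id Y).div_const δ)).const_mul (((δ : ℂ)⁻¹) ^ j)
    refine h2.congr_deriv ?_
    simp only [f, hF, Complex.real_smul, pow_succ]
    push_cast
    ring
  have hfc : ∀ j ≤ 4, ContinuousOn (f j) (Ici 0) := by
    intro j hj
    have h1 := hsys.continuousOn_streamDeriv hprof.continuous hprof.continuous₂ hj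
    have h2 : ContinuousOn (fun Y : ℝ => Y / δ) (Ici 0) := by fun_prop
    exact continuousOn_const.mul (h1.comp h2 fun Y hY => hdivpos Y hY)
  -- `w₁` is known to decay only at rate `θ/2`, so the `H⁴` membership uses that rate; the
  -- quantitative norms below avoid `w₁` and keep `θ`.
  have hweak : ∀ g : ℝ → ℂ, (∀ z, 0 ≤ z → ‖g z‖ ≤ C * Real.exp (-(θ * z))) →
      ∃ K, ∀ z, 0 ≤ z → ‖g z‖ ≤ K * Real.exp (-(θ / 2 * z)) := fun g hg => ⟨C, fun z hz =>
    (hg z hz).trans (by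
      gcongr
      linarith)⟩
  have hfb : ∀ j ≤ 4, ∃ K, ∀ Y, 0 ≤ Y → ‖f j Y‖ ≤ K * Real.exp (-(θ / 2 / δ * Y)) := by
    intro j hj
    obtain ⟨K, hK⟩ := IsFastSystem.exists_streamDeriv_bound (a := a) hprof.bounded
      (hweak ψ fun z hz => (hbd z hz).2.1) (hweak p fun z hz => (hbd z hz).2.2)
      (hweak w fun z hz => (hbd z hz).1) hw₁ hj
    refine ⟨‖((δ : ℂ)⁻¹) ^ j‖ * K, fun Y hY => ?_⟩
    rw [norm_mul, mul_assoc, ← hexp]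
    exact mul_le_mul_of_nonneg_left (hK _ (hdivpos Y hY)) (norm_nonneg _)
  let φ : SobolevH 4 := SobolevH.ofExpDecay 4 f (σ := θ / 2 / δ) (by positivity) hfderiv hfc hfb
  have hφ0 : ∀ Y, φ.d 0 Y = ψ (Y / δ) := fun Y => by
    simp [φ, SobolevH.ofExpDecay, f, hF, streamDeriv]
  have hφ1 : ∀ Y, φ.d 1 Y = (δ : ℂ)⁻¹ * (p (Y / δ) - a * ψ (Y / δ)) := fun Y => by
    simp [φ, SobolevH.ofExpDecay, f, hF, streamDeriv]
  have hφ2 : ∀ Y, φ.d 2 Y = ((δ : ℂ)⁻¹) ^ 2 * (a ^ 2 * ψ (Y / δ) + w (Y / δ)) := fun Y => by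
    simp [φ, SobolevH.ofExpDecay, f, hF, streamDeriv]
  have hφ4 : ∀ Y, φ.d 4 Y = ((δ : ℂ)⁻¹) ^ 4 * (a ^ 2 * (a ^ 2 * ψ (Y / δ) + w (Y / δ)) +
      (a ^ 2 * w (Y / δ) + Complex.I * V (Y / δ) * w (Y / δ) -
        Complex.I * V₂ (Y / δ) * ψ (Y / δ))) := fun Y => by
    simp [φ, SobolevH.ofExpDecay, f, hF, streamDeriv]
  have haα : (a : ℂ) = δ * α := by rw [ha]; push_cast; rfl
  have hhelm : ∀ Y, helmholtz α φ Y = ((δ : ℂ)⁻¹) ^ 2 * w (Y / δ) := fun Y => by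
    rw [helmholtz, hφ2, hφ0, haα]
    field_simp
    ring
  have hφc : ∀ j ≤ 4, ContinuousOn (φ.d j) (Ici 0) := hfc
  -- The `L²` norm over a layer of width `δ` gains the factor `δ^(1/2) = t`.
  have hrate : Real.sqrt (2 * (θ / δ)) = Real.sqrt (2 * θ) / t := by
    rw [← mul_div_assoc, Real.sqrt_div (by positivity), hδ, Real.sqrt_sq ht.le]
  have hbound : ∀ (g : ℝ → ℂ) (K : ℝ), 0 ≤ K → ContinuousOn g (Ici 0) →
      (∀ Y, 0 ≤ Y → ‖g Y‖ ≤ K * Real.exp (-(θ * (Y / δ)))) →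
      normL2 g ≤ K * t / Real.sqrt (2 * θ) := by
    intro g K hK hg hgb
    refine (normL2_le_of_exp_decay (σ := θ / δ) (by positivity) hK hg fun Y hY => ?_).trans
      (le_of_eq ?_)
    · rw [← hexp]
      exact hgb Y hY
    · rw [hrate]
      field_simp
  have hn0 : normL2 (φ.d 0) ≤ C * t / Real.sqrt (2 * θ) :=
    hbound _ C hC.le (hφc 0 (by norm_num)) fun Y hY => by
      rw [hφ0]
      exact (hbd _ (hdivpos Y hY)).2.1
  have hn1 : normL2 (φ.d 1) ≤ δ⁻¹ * (2 * C) * t / Real.sqrt (2 * θ) :=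
    hbound _ _ (by positivity) (hφc 1 (by norm_num)) fun Y hY => by
      obtain ⟨-, b1, b2⟩ := hbd _ (hdivpos Y hY)
      rw [hφ1, norm_mul, norm_inv, Complex.norm_real, Real.norm_of_nonneg hδpos.le, mul_assoc]
      refine mul_le_mul_of_nonneg_left ?_ (by positivity)
      refine (norm_sub_le _ _).trans ?_
      rw [norm_mul, Complex.norm_real, Real.norm_of_nonneg hapos.le]
      have := mul_le_of_le_one_left (norm_nonneg (ψ (Y / δ))) ha1
      linarith
  have hn2 : normL2 (helmholtz α φ) ≤ δ⁻¹ ^ 2 * C * t / Real.sqrt (2 * θ) := by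
    refine hbound _ _ (by positivity) ?_ fun Y hY => ?_
    · exact (hφc 2 (by norm_num)).sub (continuousOn_const.mul (hφc 0 (by norm_num)))
    · rw [hhelm, norm_mul, norm_pow, norm_inv, Complex.norm_real, Real.norm_of_nonneg hδpos.le,
        mul_assoc]
      exact mul_le_mul_of_nonneg_left (hbd _ (hdivpos Y hY)).1 (by positivity)
  refine ⟨φ, ?_, ?_, ?_, ⟨φ.d 0, hφc 0 (by norm_num), ae_eq_rfl, ?_⟩, ?_⟩
  · filter_upwards [ae_restrict_mem measurableSet_Ioi] with Y hY
    have hY0 : 0 ≤ Y := le_of_lt hY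
    have hmax : δ * max (Y / δ) 0 = Y := by
      rw [max_eq_left (hdivpos Y hY0)]
      field_simp
    have hVY : (Us Y : ℂ) = δ * V (Y / δ) := by
      rw [← Complex.ofReal_mul, hV]
      simp only [hmax]
      congr 1
      field_simp
    have hV₂Y : ((iteratedDerivWithin 2 Us (Ici 0) Y : ℝ) : ℂ) = (δ : ℂ)⁻¹ * V₂ (Y / δ) := by
      rw [← Complex.ofReal_inv, ← Complex.ofReal_mul, hV₂]
      simp only [hmax]
      congr 1
      field_simp
    have hε3 : ((t ^ 6 : ℝ) : ℂ) = (δ : ℂ) ^ 3 := by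
      rw [hδ]
      push_cast
      ring
    -- After substitution the terms `a²w` cancel and `i² = -1` cancels the rest.
    rw [orrSommerfeld, rayleigh, helmholtzSq, hhelm, hφ0, hφ2, hφ4, hVY, hV₂Y, hε3, haα]
    generalize V (Y / δ) = v
    generalize V₂ (Y / δ) = v₂
    field_simp
    linear_combination (v * w (Y / δ) - v₂ * ψ (Y / δ)) * Complex.I_sq
  · have h1 : α * normL2 (φ.d 0) ≤ δ⁻¹ * C * t / Real.sqrt (2 * θ) := by
      calc α * normL2 (φ.d 0) ≤ α * (C * t / Real.sqrt (2 * θ)) := by gcongr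
        _ = a * (δ⁻¹ * C * t / Real.sqrt (2 * θ)) := by rw [ha]; field_simp
        _ ≤ 1 * (δ⁻¹ * C * t / Real.sqrt (2 * θ)) := by gcongr
        _ = _ := one_mul _
    calc _ ≤ δ⁻¹ * (2 * C) * t / Real.sqrt (2 * θ) + δ⁻¹ * C * t / Real.sqrt (2 * θ) :=
          add_le_add hn1 h1
      _ = 3 * C / Real.sqrt (2 * θ) / t := by rw [hδ]; field_simp; ring
      _ ≤ _ := by gcongr; linarith
  · calc _ ≤ δ⁻¹ ^ 2 * C * t / Real.sqrt (2 * θ) := hn2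
      _ = C / Real.sqrt (2 * θ) / t ^ 3 := by rw [hδ]; field_simp
      _ ≤ _ := by
        gcongr
        have : 0 < C / Real.sqrt (2 * θ) := by positivity
        rw [mul_div_assoc]
        linarith
  · rw [hφ0, zero_div, hψ0]
  · obtain ⟨r, s, hrs, hr, hs⟩ := exists_split_of_norm_le hδpos hapos.le hcoef
    have hC' : C ≤ C + 3 * C / Real.sqrt (2 * θ) := le_add_of_nonneg_right (by positivity)
    refine ⟨r, s, hr.trans (by gcongr), hs.trans (by gcongr),
      φ.d 1, hφc 1 (by norm_num), ae_eq_rfl, ?_⟩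
    rw [hφ1, zero_div, hψ0, mul_one, Complex.ofReal_inv]
    linear_combination (δ : ℂ)⁻¹ * hrs
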